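/- Let $X$ be a connected complex manifold of dimension $n\ge 2$ (Hausdorff) and let $Y\subset X$ be a nonempty, connected, closed complex submanifold of complex codimension $2$. Let $\pi:W\to X$ be the blow-up of $X$ along $Y$; that is, $\pi$ is a holomorphic map of complex $n$-manifolds that is biholomorphic over $X\setminus Y$, and every point of $Y$ has a coordinate patch $\varphi=(z_1,\dots,z_n):U\to\mathbb{C}^n$ with $Y\cap U=\{z_1=z_2=0\}$ over which $\pi^{-1}(U)\to U$ is identified, by a biholomorphism over $\varphi$, with the projection to $\varphi(U)$ of $$\{(z,[x_1,x_2])\in \varphi(U)\times\mathbb{C}P(1)\;:\; z_1x_2=z_2x_1\}.$$ Let $FP=\{(w,w')\in W\times W : \pi(w)=\pi(w')\}$ be the fibered product of $\pi$ with itself, and let $p:FP\to X$, $p(w,w')=\pi(w)$. Irreducible components of $FP$ are its maximal irreducible subsets for the analytic Zariski topology, i.e. the topology on $W\times W$ whose closed sets are generated by the analytic subsets (those given, near every point of $W\times W$, as the set of common zeros of finitely many holomorphic functions). Then $FP$ has exactly two irreducible components: 1. $C_1=p^{-1}(Y)$. The map $p:C_1\to Y$ is a holomorphic fiber bundle over the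 singular locus $Y$ with fiber $\mathbb{C}P(1)\times\mathbb{C}P(1)$; over a neighborhood $V$ of each point of $Y$ it has a local trivialization $V\times\mathbb{C}P(1)\times\mathbb{C}P(1)\to p^{-1}(V)$ over $V$ that is a holomorphic embedding into $W\times W$. 2. $C_2=\overline{p^{-1}(X\setminus Y)}$. It is a copy of the original blow-up: there is a holomorphic embedding $\delta:W\to W\times W$ with image $C_2$ and $p\circ\delta=\pi$. -/

import Mathlib

open Set Topology Manifold
open scoped ContDiff LinearAlgebra.Projectivization

/-! ### The complex projective line as a complex manifold -/

/-- The complex projective line, the set of lines through the origin of `ℂ²`. -/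
def ComplexProjectiveLine : Type := ℙ ℂ (Fin 2 → ℂ)

namespace ComplexProjectiveLine

/-- The point `[v 0 : v 1]` with homogeneous coordinates `v`. -/
noncomputable def mk (v : {v : Fin 2 → ℂ // v ≠ 0}) : ComplexProjectiveLine :=
  Projectivization.mk ℂ v.1 v.2

/-- The quotient topology of `ℂ² ∖ {0}`. -/
noncomputable instance : TopologicalSpace ComplexProjectiveLine :=
  TopologicalSpace.coinduced mk inferInstance

theorem isQuotientMap_mk : IsQuotientMap mk where
  surjective l := by
    induction l using Projectivization.ind with
    | h v hv => exact ⟨⟨v, hv⟩, rfl⟩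
  eq_coinduced := rfl

theorem mk_eq_mk_iff (v w : {v : Fin 2 → ℂ // v ≠ 0}) :
    mk v = mk w ↔ ∃ a : ℂ, a • w.1 = v.1 :=
  Projectivization.mk_eq_mk_iff' ℂ v.1 w.1 v.2 w.2

/-- The set of points whose `i`-th homogeneous coordinate does not vanish. -/
def nonvanishing (i : Fin 2) : Set ComplexProjectiveLine :=
  {l | ∃ v : {v : Fin 2 → ℂ // v ≠ 0}, l = mk v ∧ v.1 i ≠ 0}

theorem mk_mem_nonvanishing (i : Fin 2) (v : {v : Fin 2 → ℂ // v ≠ 0}) :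
    mk v ∈ nonvanishing i ↔ v.1 i ≠ 0 := by
  constructor
  · rintro ⟨w, hw, hi⟩
    obtain ⟨a, ha⟩ := (mk_eq_mk_iff w v).1 hw.symm
    intro h0
    apply hi
    rw [← ha]
    simp [h0]
  · intro h
    exact ⟨v, rfl, h⟩

theorem isOpen_nonvanishing (i : Fin 2) : IsOpen (nonvanishing i) := by
  rw [← isQuotientMap_mk.isOpen_preimage]
  have : mk ⁻¹' nonvanishing i = {v | v.1 i ≠ 0} := by
    ext v
    exact mk_mem_nonvanishing i v
  rw [this]
  exact isOpen_ne_fun ((continuous_apply i).comp continuous_subtype_val) continuous_const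

/-- The affine coordinate: the ratio of the other homogeneous coordinate by the `i`-th one. -/
noncomputable def ratio (i : Fin 2) : ComplexProjectiveLine → ℂ :=
  Projectivization.lift (fun v : {v : Fin 2 → ℂ // v ≠ 0} => v.1 (i + 1) / v.1 i) (by
    intro a b t hab
    have ht : t ≠ 0 := by
      rintro rfl
      exact a.2 (by simpa using hab)
    simp only [hab, Pi.smul_apply, smul_eq_mul]
    rw [mul_div_mul_left _ _ ht])

theorem ratio_mk (i : Fin 2) (v : {v : Fin 2 → ℂ // v ≠ 0}) :
    ratio i (mk v) = v.1 (i + 1) / v.1 i := rfl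

/-- The vector whose `i`-th coordinate is `1` and whose other coordinate is `z`. -/
noncomputable def affineVec (i : Fin 2) (z : ℂ) : {v : Fin 2 → ℂ // v ≠ 0} :=
  ⟨fun j => if j = i then 1 else z, fun h => by simpa using congrFun h i⟩

/-- The affine chart of the projective line on the set where the `i`-th homogeneous coordinate
does not vanish. -/
noncomputable def affineChart (i : Fin 2) : OpenPartialHomeomorph ComplexProjectiveLine ℂ where
  toFun := ratio i
  invFun z := mk (affineVec i z)
  source := nonvanishing i
  target := univ
  map_source' _ _ := mem_univ _
  map_target' z _ := by
    rw [mk_mem_nonvanishing]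
    simp [affineVec]
  left_inv' := by
    rintro _ ⟨v, rfl, hv⟩
    rw [ratio_mk, mk_eq_mk_iff]
    refine ⟨(v.1 i)⁻¹, ?_⟩
    funext j
    have hj : j = i ∨ j = i + 1 := by
      fin_cases i <;> fin_cases j <;> simp
    rcases hj with rfl | rfl
    · simp [affineVec, hv]
    · simp [affineVec, div_eq_inv_mul]
  right_inv' z _ := by
    rw [ratio_mk]
    simp [affineVec]
  open_source := isOpen_nonvanishing i
  open_target := isOpen_univ
  continuousOn_toFun := by
    rw [isQuotientMap_mk.continuousOn_isOpen_iff (isOpen_nonvanishing i)]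
    have h : ratio i ∘ mk = fun v => v.1 (i + 1) / v.1 i := rfl
    rw [h]
    refine ContinuousOn.div ((continuous_apply _).comp continuous_subtype_val).continuousOn
      ((continuous_apply _).comp continuous_subtype_val).continuousOn ?_
    intro v hv
    exact (mk_mem_nonvanishing i v).1 hv
  continuousOn_invFun := by
    refine (isQuotientMap_mk.continuous.comp ?_).continuousOn
    refine Continuous.subtype_mk (continuous_pi fun j => ?_) _
    by_cases hj : j = i
    · simp only [hj, if_true]
      exact continuous_const
    · simp only [hj, if_false]
      exact continuous_id

theorem exists_mem_nonvanishing (l : ComplexProjectiveLine) : ∃ i, l ∈ nonvanishing i := by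
  obtain ⟨v, rfl⟩ := isQuotientMap_mk.surjective l
  by_contra! h
  refine v.2 (funext fun i => ?_)
  by_contra hi
  exact h i ((mk_mem_nonvanishing i v).2 hi)

noncomputable instance : ChartedSpace ℂ ComplexProjectiveLine where
  atlas := range affineChart
  chartAt l := affineChart (exists_mem_nonvanishing l).choose
  mem_chart_source l := (exists_mem_nonvanishing l).choose_spec
  chart_mem_atlas _ := mem_range_self _

instance : IsManifold 𝓘(ℂ, ℂ) ω ComplexProjectiveLine := by
  apply isManifold_of_contDiffOn
  rintro _ _ ⟨i, rfl⟩ ⟨j, rfl⟩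
  by_cases hij : j = i
  · subst hij
    refine contDiffOn_id.congr ?_
    rintro z -
    exact (affineChart j).right_inv (mem_univ z)
  · have hji : j + 1 = i := by
      revert hij
      fin_cases i <;> fin_cases j <;> simp
    have hz : ∀ z ∈ (𝓘(ℂ, ℂ)).symm ⁻¹'
        ((affineChart i).symm ≫ₕ affineChart j).source ∩ range 𝓘(ℂ, ℂ), z ≠ 0 := by
      rintro z ⟨⟨-, h⟩, -⟩
      have h' := (mk_mem_nonvanishing j (affineVec i z)).1 h
      simpa [affineVec, hij] using h'
    refine (contDiffOn_id.inv hz).congr ?_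
    intro z _
    change ratio j (mk (affineVec i z)) = z⁻¹
    rw [ratio_mk, hji]
    simp [affineVec, hij]

end ComplexProjectiveLine

/-! ### Irreducible components in the analytic Zariski topology -/

section Analytic

variable {E : Type*} [NormedAddCommGroup E] [NormedSpace ℂ E] {H : Type*} [TopologicalSpace H]
  (I : ModelWithCorners ℂ E H) {M : Type*} [TopologicalSpace M] [ChartedSpace H M]

/-- `A` is a (closed) analytic subset of the complex manifold `M`: around each point of `M` it is
the set of common zeros of finitely many holomorphic functions. -/
def IsAnalyticSubset (A : Set M) : Prop :=
  ∀ x : M, ∃ U : Set M, IsOpen U ∧ x ∈ U ∧ ∃ (k : ℕ) (f : M → Fin k → ℂ),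
    ContMDiffOn I 𝓘(ℂ, Fin k → ℂ) ω f U ∧ ∀ y ∈ U, y ∈ A ↔ f y = 0

variable (M) in
/-- The analytic Zariski topology of a complex manifold: the topology whose closed sets are
generated by the analytic subsets. -/
abbrev analyticZariskiTopology : TopologicalSpace M :=
  TopologicalSpace.generateFrom {U | IsAnalyticSubset I Uᶜ}

/-- The irreducible components of a subset `Z` of a complex manifold: the maximal irreducible
subsets of `Z`, for the analytic Zariski topology. -/
def analyticComponents (Z : Set M) : Set (Set M) :=
  {C | Maximal (fun V => V ⊆ Z ∧ @IsIrreducible M (analyticZariskiTopology I M) V) C}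

end Analytic

/-! ### Blow-ups and bundles -/

/-- `φ` is a holomorphic coordinate patch `(z₁, …, zₙ)` of `X`, `n = m + 2`, in which `Y` is given
by the equations `z₁ = z₂ = 0`. -/
def IsAdaptedChart {m : ℕ} {X : Type*} [TopologicalSpace X] [ChartedSpace (Fin (m + 2) → ℂ) X]
    (Y : Set X) (φ : OpenPartialHomeomorph X (Fin (m + 2) → ℂ)) : Prop :=
  φ ∈ IsManifold.maximalAtlas 𝓘(ℂ, Fin (m + 2) → ℂ) ω X ∧
    ∀ x ∈ φ.source, x ∈ Y ↔ φ x 0 = 0 ∧ φ x 1 = 0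

/-- The blow-up `{(z₁, …, zₙ, [x₁ : x₂]) | z₁ x₂ = z₂ x₁}` of `ℂⁿ` along `z₁ = z₂ = 0`,
`n = m + 2`, as a subset of `ℂⁿ × ℂP(1)`. -/
def localBlowUp (m : ℕ) : Set ((Fin (m + 2) → ℂ) × ComplexProjectiveLine) :=
  {p | ∃ v : {v : Fin 2 → ℂ // v ≠ 0},
    p.2 = ComplexProjectiveLine.mk v ∧ p.1 0 * v.1 1 = p.1 1 * v.1 0}

/-- `π : W → X` is the blow-up of the complex manifold `X` along the codimension 2 submanifold `Y`:
`π` is holomorphic, it is biholomorphic over `X ∖ Y`, and near each point of `Y` there is a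
coordinate patch `φ : U → ℂⁿ` adapted to `Y` such that `π⁻¹ U → U` is identified by a biholomorphism
over `φ` with the part over `φ U` of the local blow-up of `ℂⁿ` along `z₁ = z₂ = 0`. -/
structure IsBlowUp (m : ℕ)
    {X : Type*} [TopologicalSpace X] [ChartedSpace (Fin (m + 2) → ℂ) X]
    {W : Type*} [TopologicalSpace W] [ChartedSpace (Fin (m + 2) → ℂ) W]
    (π : W → X) (Y : Set X) : Prop where
  holomorphic : ContMDiff 𝓘(ℂ, Fin (m + 2) → ℂ) 𝓘(ℂ, Fin (m + 2) → ℂ) ω π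
  bijOn : BijOn π (π ⁻¹' Yᶜ) Yᶜ
  isLocalDiffeomorphAt : ∀ w, π w ∉ Y →
    IsLocalDiffeomorphAt 𝓘(ℂ, Fin (m + 2) → ℂ) 𝓘(ℂ, Fin (m + 2) → ℂ) ω π w
  locally_eq : ∀ y ∈ Y, ∃ φ : OpenPartialHomeomorph X (Fin (m + 2) → ℂ),
    y ∈ φ.source ∧ IsAdaptedChart Y φ ∧
    ∃ O : TopologicalSpace.Opens W, (O : Set W) = π ⁻¹' φ.source ∧
    ∃ g : O → ComplexProjectiveLine,
      IsSmoothEmbedding 𝓘(ℂ, Fin (m + 2) → ℂ) (𝓘(ℂ, Fin (m + 2) → ℂ).prod 𝓘(ℂ, ℂ)) ω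
        (fun w : O => (φ (π w), g w)) ∧
      range (fun w : O => (φ (π w), g w)) = localBlowUp m ∩ φ.target ×ˢ univ

/-- A subset `C` of a complex manifold `M` is a holomorphic fiber bundle with fiber `F` over the
complex manifold `B`, with projection `q`: over a neighborhood `V` of each point of `B` there is a
local trivialization `V × F → q⁻¹ V`, biholomorphic onto the complex submanifold `q⁻¹ V` of `M`. -/
def IsHolomorphicFiberBundle
    {EB : Type*} [NormedAddCommGroup EB] [NormedSpace ℂ EB] {HB : Type*} [TopologicalSpace HB]
    (IB : ModelWithCorners ℂ EB HB) {B : Type*} [TopologicalSpace B] [ChartedSpace HB B]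
    {EF : Type*} [NormedAddCommGroup EF] [NormedSpace ℂ EF] {HF : Type*} [TopologicalSpace HF]
    (IF : ModelWithCorners ℂ EF HF) (F : Type*) [TopologicalSpace F] [ChartedSpace HF F]
    {EM : Type*} [NormedAddCommGroup EM] [NormedSpace ℂ EM] {HM : Type*} [TopologicalSpace HM]
    (IM : ModelWithCorners ℂ EM HM) {M : Type*} [TopologicalSpace M] [ChartedSpace HM M]
    (C : Set M) (q : C → B) : Prop :=
  Continuous q ∧ ∀ b : B, ∃ V : TopologicalSpace.Opens B, b ∈ V ∧ ∃ Φ : V × F → C,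
    IsSmoothEmbedding (IB.prod IF) IM ω (fun p => (Φ p : M)) ∧
    (∀ p, q (Φ p) = p.1) ∧ range Φ = q ⁻¹' V

/-- The fibered product of two maps `p : A → X` and `q : B → X`. -/
def fiberedProduct {A B X : Type*} (p : A → X) (q : B → X) : Set (A × B) :=
  {c | p c.1 = q c.2}

/-! ### Analytic subsets and irreducibility -/

section AnalyticSubset

variable {E : Type*} [NormedAddCommGroup E] [NormedSpace ℂ E] {H : Type*} [TopologicalSpace H]
  {I : ModelWithCorners ℂ E H} {M : Type*} [TopologicalSpace M] [ChartedSpace H M]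
  {E' : Type*} [NormedAddCommGroup E'] [NormedSpace ℂ E'] {H' : Type*} [TopologicalSpace H']
  {I' : ModelWithCorners ℂ E' H'} {N : Type*} [TopologicalSpace N] [ChartedSpace H' N]

namespace IsAnalyticSubset

/-! Off `Y` the map `π` is injective, so a point `(w, w')` of the fibered product either lies over
`Y` or has `w = w'`. Hence the fibered product is `C₁ ∪ diagonal W`, and it remains to see that
these are incomparable closed irreducible sets (`analyticComponents_union`).

Closedness: the diagonal is analytic in `W × W`, and `C₁` is cut out by pulling back the diagonal of
`X` and the center `Y`.

Irreducibility rests on the identity theorem `IsAnalyticSubset.eq_univ`: a nonempty Zariski open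
subset of a connected manifold is dense in the usual topology. So holomorphic images of connected
manifolds are irreducible, which settles the diagonal, the image of `W`. For `C₁` the same
principle, applied in each local trivialization, propagates along the connected base `Y`
(`isIrreducible_of_trivializations`).

The trivializations come from the local model: over a point of `z₁ = z₂ = 0` the equation `z₁ x₂ =
z₂ x₁` is void, so the fiber of `π` is a whole projective line, and the fiber of `C₁` a product of
two. In affine coordinates the trivialization is an injective linear map, hence an immersion.

Finally `π⁻¹ (X ∖ Y)` is dense in `W`, again by the identity theorem, so the diagonal is the closure
of the part over `X ∖ Y`. That `W` is Hausdorff and connected is deduced from the same properties of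
`X`. -/

theorem isClosed {A : Set M} (hA : IsAnalyticSubset I A) : IsClosed A := by
  rw [← isOpen_compl_iff, isOpen_iff_mem_nhds]
  intro x hx
  obtain ⟨U, hU, hxU, k, f, hf, hfA⟩ := hA x
  have hne : f x ≠ 0 := fun h => hx ((hfA x hxU).2 h)
  filter_upwards [hU.mem_nhds hxU,
    (hf.continuousOn.continuousAt (hU.mem_nhds hxU)).eventually_ne hne] with y hy hy' hyA
  exact hy' ((hfA y hy).1 hyA)

theorem preimage {A : Set M} (hA : IsAnalyticSubset I A) {g : N → M} (hg : ContMDiff I' I ω g) :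
    IsAnalyticSubset I' (g ⁻¹' A) := by
  intro x
  obtain ⟨U, hU, hxU, k, f, hf, hfA⟩ := hA (g x)
  exact ⟨g ⁻¹' U, hU.preimage hg.continuous, hxU, k, f ∘ g, hf.comp hg.contMDiffOn Subset.rfl,
    fun y hy => hfA _ hy⟩

/-- For a closed set, it suffices to give local equations around its points. -/
theorem of_isClosed {A : Set M} (hA : IsClosed A)
    (h : ∀ x ∈ A, ∃ U : Set M, IsOpen U ∧ x ∈ U ∧ ∃ (k : ℕ) (f : M → Fin k → ℂ),
      ContMDiffOn I 𝓘(ℂ, Fin k → ℂ) ω f U ∧ ∀ y ∈ U, y ∈ A ↔ f y = 0) :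
    IsAnalyticSubset I A := by
  intro x
  by_cases hx : x ∈ A
  · exact h x hx
  · refine ⟨Aᶜ, hA.isOpen_compl, hx, 1, fun _ _ => 1, contMDiffOn_const, fun y hy => ?_⟩
    exact ⟨fun h => absurd h hy, fun h => absurd (congrFun h 0) one_ne_zero⟩

/-- Near a diagonal point the difference of the coordinates of the two factors gives the equations;
elsewhere the Hausdorff property suffices. -/
theorem diagonal (k : ℕ) (M : Type*) [TopologicalSpace M] [T2Space M]
    [ChartedSpace (Fin k → ℂ) M] [IsManifold 𝓘(ℂ, Fin k → ℂ) ω M] :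
    IsAnalyticSubset (𝓘(ℂ, Fin k → ℂ).prod 𝓘(ℂ, Fin k → ℂ)) (Set.diagonal M) := by
  refine of_isClosed isClosed_diagonal ?_
  rintro ⟨a, b⟩ (rfl : a = b)
  have hc := contMDiffOn_of_mem_maximalAtlas
    (IsManifold.chart_mem_maximalAtlas (I := 𝓘(ℂ, Fin k → ℂ)) (n := ω) a)
  refine ⟨(chartAt (Fin k → ℂ) a).source ×ˢ (chartAt (Fin k → ℂ) a).source,
    (chartAt _ a).open_source.prod (chartAt _ a).open_source,
    ⟨mem_chart_source _ a, mem_chart_source _ a⟩, k,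
    fun p => chartAt (Fin k → ℂ) a p.1 - chartAt (Fin k → ℂ) a p.2, ?_, ?_⟩
  · exact (hc.comp contMDiffOn_fst fun p hp => hp.1).sub
      (hc.comp contMDiffOn_snd fun p hp => hp.2)
  · rintro ⟨p, q⟩ ⟨hp, hq⟩
    rw [mem_diagonal_iff, sub_eq_zero]
    exact ⟨fun h => congrArg _ h, fun h => (chartAt (Fin k → ℂ) a).injOn hp hq h⟩

/-- The identity theorem: an analytic subset of a connected manifold that has an interior point is
the whole manifold. -/
theorem eq_univ [I.Boundaryless] [IsManifold I ω M] [PreconnectedSpace M]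
    {A : Set M} (hA : IsAnalyticSubset I A) (hi : (interior A).Nonempty) : A = univ := by
  suffices h : IsClosed (interior A) by
    have := IsClopen.eq_univ ⟨h, isOpen_interior⟩ hi
    exact eq_univ_of_univ_subset (this ▸ interior_subset)
  -- On a ball in a chart around a closure point `x`, the local equations are analytic and vanish
  -- identically near some point, hence on the whole ball; so `x` is interior.
  refine isClosed_of_closure_subset fun x hx => ?_
  obtain ⟨U, hU, hxU, k, f, hf, hfA⟩ := hA x
  set c := extChartAt I x
  have hcx : c x ∈ c.target := mem_extChartAt_target x
  have hcs : ContMDiffOn 𝓘(ℂ, E) I ω c.symm c.target := contMDiffOn_extChartAt_symm x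
  have hopen : IsOpen (c.target ∩ c.symm ⁻¹' U) :=
    hcs.continuousOn.isOpen_inter_preimage (isOpen_extChartAt_target x) hU
  have hxm : c x ∈ c.target ∩ c.symm ⁻¹' U := ⟨hcx, by
    rw [mem_preimage, extChartAt_to_inv]; exact hxU⟩
  obtain ⟨r, hr, hball⟩ := Metric.isOpen_iff.1 hopen _ hxm
  set b := Metric.ball (c x) r
  have hfc : ContMDiffOn 𝓘(ℂ, E) 𝓘(ℂ, Fin k → ℂ) ω (f ∘ c.symm) b :=
    hf.comp (hcs.mono fun u hu => (hball hu).1) fun u hu => (hball hu).2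
  have han : AnalyticOnNhd ℂ (f ∘ c.symm) b :=
    (Metric.isOpen_ball.analyticOn_iff_analyticOnNhd).1 (contMDiffOn_iff_contDiffOn.1 hfc).analyticOn
  have hbo : IsOpen (c.source ∩ c ⁻¹' b) :=
    (continuousOn_extChartAt x).isOpen_inter_preimage (isOpen_extChartAt_source x)
      Metric.isOpen_ball
  have hxb : x ∈ c.source ∩ c ⁻¹' b :=
    ⟨mem_extChartAt_source x, Metric.mem_ball_self hr⟩
  obtain ⟨p, ⟨hps, hpb⟩, hpA⟩ := mem_closure_iff.1 hx _ hbo hxb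
  have hz : f ∘ c.symm =ᶠ[𝓝 (c p)] 0 := by
    have hcp : ContinuousAt c.symm (c p) :=
      (hcs.continuousOn.continuousAt ((isOpen_extChartAt_target x).mem_nhds (hball hpb).1))
    have h1 : c.symm ⁻¹' interior A ∈ 𝓝 (c p) := by
      refine hcp (isOpen_interior.mem_nhds ?_)
      rw [c.left_inv hps]; exact hpA
    filter_upwards [h1, Metric.isOpen_ball.mem_nhds hpb] with u hu hub
    exact (hfA _ (hball hub).2).1 (interior_subset hu)
  have hzero := han.eqOn_zero_of_preconnected_of_eventuallyEq_zero
    (convex_ball (c x) r).isPreconnected hpb hz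
  refine mem_interior.2 ⟨_, ?_, hbo, hxb⟩
  rintro u ⟨hus, hub⟩
  have h1 := hzero hub
  have h2 := (hball hub).2
  rw [mem_preimage, c.left_inv hus] at h2
  refine (hfA u h2).2 ?_
  simpa [c.left_inv hus] using h1

end IsAnalyticSubset

theorem isClosed_analyticZariskiTopology {A : Set M} (hA : IsAnalyticSubset I A) :
    IsClosed[analyticZariskiTopology I M] A := by
  let := analyticZariskiTopology I M
  rw [← isOpen_compl_iff]
  exact TopologicalSpace.isOpen_generateFrom_of_mem (by simpa using hA)

/-- A nonempty Zariski open subset of a connected manifold is open and dense. -/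
theorem isOpen_and_dense_of_isOpen_analyticZariskiTopology [I.Boundaryless] [IsManifold I ω M]
    [PreconnectedSpace M] {u : Set M} (hu : IsOpen[analyticZariskiTopology I M] u)
    (hne : u.Nonempty) : IsOpen u ∧ Dense u := by
  induction hu with
  | basic s hs =>
    have hs : IsAnalyticSubset I sᶜ := hs
    refine ⟨by simpa using hs.isClosed.isOpen_compl, ?_⟩
    rw [← compl_compl s, ← interior_eq_empty_iff_dense_compl, ← not_nonempty_iff_eq_empty]
    intro h
    have := hs.eq_univ h
    rw [compl_univ_iff] at this
    exact hne.ne_empty this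
  | univ => exact ⟨isOpen_univ, dense_univ⟩
  | inter s t _ _ ihs iht =>
    obtain ⟨hs, hs'⟩ := ihs (hne.mono inter_subset_left)
    obtain ⟨ht, ht'⟩ := iht (hne.mono inter_subset_right)
    exact ⟨hs.inter ht, hs'.inter_of_isOpen_left ht' hs⟩
  | sUnion S _ ih =>
    obtain ⟨x, s, hs, hxs⟩ := hne
    refine ⟨?_, (ih s hs ⟨x, hxs⟩).2.mono (subset_sUnion_of_mem hs)⟩
    refine isOpen_sUnion fun t ht => ?_
    -- The induction hypothesis only covers nonempty members of the union.
    rcases t.eq_empty_or_nonempty with rfl | h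
    · exact isOpen_empty
    · exact (ih t ht h).1

theorem isOpen_preimage_analyticZariskiTopology {g : N → M} (hg : ContMDiff I' I ω g)
    {u : Set M} (hu : IsOpen[analyticZariskiTopology I M] u) :
    IsOpen[analyticZariskiTopology I' N] (g ⁻¹' u) := by
  have : @Continuous N M (analyticZariskiTopology I' N) (analyticZariskiTopology I M) g := by
    refine continuous_generateFrom_iff.2 fun s hs => ?_
    exact TopologicalSpace.isOpen_generateFrom_of_mem (IsAnalyticSubset.preimage hs hg)
  exact @IsOpen.preimage _ _ (_) (_) _ this _ hu

/-- The holomorphic image of a connected manifold is irreducible. -/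
theorem isIrreducible_range_of_contMDiff [I'.Boundaryless] [IsManifold I' ω N] [ConnectedSpace N]
    {g : N → M} (hg : ContMDiff I' I ω g) :
    @IsIrreducible M (analyticZariskiTopology I M) (range g) := by
  refine ⟨range_nonempty g, ?_⟩
  rintro u v hu hv ⟨_, ⟨a, rfl⟩, ha⟩ ⟨_, ⟨b, rfl⟩, hb⟩
  obtain ⟨hu1, hu2⟩ := isOpen_and_dense_of_isOpen_analyticZariskiTopology
    (isOpen_preimage_analyticZariskiTopology hg hu) ⟨a, ha⟩
  obtain ⟨hv1, hv2⟩ := isOpen_and_dense_of_isOpen_analyticZariskiTopology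
    (isOpen_preimage_analyticZariskiTopology hg hv) ⟨b, hb⟩
  obtain ⟨c, hc1, hc2⟩ := hv2.inter_open_nonempty _ hu1 ⟨a, ha⟩
  exact ⟨g c, ⟨c, rfl⟩, hc1, hc2⟩

/-- A holomorphic fiber bundle with connected fiber over a connected base is irreducible. -/
theorem isIrreducible_of_trivializations
    {EB : Type*} [NormedAddCommGroup EB] [NormedSpace ℂ EB] {HB : Type*} [TopologicalSpace HB]
    {IB : ModelWithCorners ℂ EB HB} [IB.Boundaryless]
    {B : Type*} [TopologicalSpace B] [ChartedSpace HB B] [IsManifold IB ω B] [ConnectedSpace B]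
    {EF : Type*} [NormedAddCommGroup EF] [NormedSpace ℂ EF] {HF : Type*} [TopologicalSpace HF]
    {IF : ModelWithCorners ℂ EF HF} [IF.Boundaryless]
    {F : Type*} [TopologicalSpace F] [ChartedSpace HF F] [IsManifold IF ω F] [ConnectedSpace F]
    {C : Set M} {q : C → B}
    (h : ∀ b : B, ∃ V : TopologicalSpace.Opens B, b ∈ V ∧ ConnectedSpace V ∧ ∃ Φ : V × F → C,
      ContMDiff (IB.prod IF) I ω (fun p => (Φ p : M)) ∧
      (∀ p, q (Φ p) = p.1) ∧ range Φ = q ⁻¹' V) :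
    @IsIrreducible M (analyticZariskiTopology I M) C := by
  choose V hbV hV Φ hΦ hqΦ hrange using h
  -- A Zariski open set that meets `C` meets every trivialized piece, so that irreducibility of `C`
  -- reduces to that of a single piece.
  have hpre : ∀ u : Set M, IsOpen[analyticZariskiTopology I M] u → (C ∩ u).Nonempty →
      ∀ b, ((fun p => (Φ b p : M)) ⁻¹' u).Nonempty := by
    intro u hu hne b
    by_contra hb
    have hempty : ∀ p, (Φ b p : M) ∉ u := fun p hp => hb ⟨p, hp⟩
    -- `S` consists of the base points near which the bundle misses `u`. It is shown to be clopen;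
    -- if one piece missed `u`, all of `C` would.
    let S : Set B := {y | ∃ O : Set B, IsOpen O ∧ y ∈ O ∧ ∀ c : C, q c ∈ O → (c : M) ∉ u}
    have hSo : IsOpen S := by
      rw [isOpen_iff_forall_mem_open]
      rintro y ⟨O, hO, hyO, h⟩
      exact ⟨O, fun z hz => ⟨O, hO, hz, h⟩, hO, hyO⟩
    -- If `u` met the piece over `V y`, it would be dense there, and so would also meet the part
    -- over the open set `O`.
    have hall : ∀ y, (∃ p, p ∈ S ∧ p ∈ V y) → ∀ c : C, q c ∈ V y → (c : M) ∉ u := by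
      rintro y ⟨p, ⟨O, hO, hpO, hOu⟩, hpV⟩ c hc hcu
      obtain ⟨d, rfl⟩ : c ∈ range (Φ y) := by rw [hrange]; exact hc
      have hd := (isOpen_and_dense_of_isOpen_analyticZariskiTopology
        (isOpen_preimage_analyticZariskiTopology (hΦ y) hu) ⟨d, hcu⟩).2
      obtain ⟨e, he1, he2⟩ := hd.inter_open_nonempty {e | (e.1 : B) ∈ O}
        (hO.preimage (continuous_subtype_val.comp continuous_fst)) ⟨(⟨p, hpV⟩, d.2), hpO⟩
      exact hOu (Φ y e) (by rw [hqΦ]; exact he1) he2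
    have hSc : IsClosed S := by
      refine isClosed_of_closure_subset fun y hy => ?_
      obtain ⟨p, hp, hpS⟩ := mem_closure_iff.1 hy _ (V y).isOpen (hbV y)
      exact ⟨V y, (V y).isOpen, hbV y, hall y ⟨p, hpS, hp⟩⟩
    have hbS : b ∈ S := by
      refine ⟨V b, (V b).isOpen, hbV b, fun c hc => ?_⟩
      obtain ⟨d, rfl⟩ : c ∈ range (Φ b) := by rw [hrange]; exact hc
      exact hempty d
    have hS : S = univ := IsClopen.eq_univ ⟨hSc, hSo⟩ ⟨b, hbS⟩
    obtain ⟨c, hcC, hcu⟩ := hne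
    obtain ⟨O, -, hO, h⟩ : q ⟨c, hcC⟩ ∈ S := hS ▸ mem_univ _
    exact h ⟨c, hcC⟩ hO hcu
  obtain ⟨b⟩ : Nonempty B := inferInstance
  obtain ⟨f⟩ : Nonempty F := inferInstance
  refine ⟨⟨_, (Φ b (⟨b, hbV b⟩, f)).2⟩, fun u v hu hv hu' hv' => ?_⟩
  have hir := (isIrreducible_range_of_contMDiff (hΦ b)).2 u v hu hv
  obtain ⟨p, hp⟩ := hpre u hu hu' b
  obtain ⟨p', hp'⟩ := hpre v hv hv' b
  obtain ⟨_, ⟨c, rfl⟩, hc⟩ := hir ⟨_, ⟨p, rfl⟩, hp⟩ ⟨_, ⟨p', rfl⟩, hp'⟩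
  exact ⟨_, (Φ b c).2, hc⟩

/-- A union of two incomparable closed irreducible subsets has these as irreducible components. -/
theorem analyticComponents_union {C₁ C₂ : Set M}
    (hc₁ : IsClosed[analyticZariskiTopology I M] C₁)
    (hc₂ : IsClosed[analyticZariskiTopology I M] C₂)
    (hi₁ : @IsIrreducible M (analyticZariskiTopology I M) C₁)
    (hi₂ : @IsIrreducible M (analyticZariskiTopology I M) C₂)
    (h₁₂ : ¬ C₁ ⊆ C₂) (h₂₁ : ¬ C₂ ⊆ C₁) :
    analyticComponents I (C₁ ∪ C₂) = {C₁, C₂} := by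
  let := analyticZariskiTopology I M
  have key : ∀ V : Set M, V ⊆ C₁ ∪ C₂ → IsIrreducible V → V ⊆ C₁ ∨ V ⊆ C₂ := fun V hV hi =>
    isPreirreducible_iff_isClosed_union_isClosed.1 hi.2 C₁ C₂ hc₁ hc₂ hV
  ext V
  simp only [mem_insert_iff, mem_singleton_iff]
  constructor
  · rintro ⟨⟨hV, hi⟩, hmax⟩
    rcases key V hV hi with h | h
    · exact Or.inl (h.antisymm (hmax ⟨subset_union_left, hi₁⟩ h))
    · exact Or.inr (h.antisymm (hmax ⟨subset_union_right, hi₂⟩ h))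
  · rintro (rfl | rfl)
    · refine ⟨⟨subset_union_left, hi₁⟩, fun V' hV' hle => ?_⟩
      exact (key V' hV'.1 hV'.2).resolve_right fun h => h₁₂ (hle.trans h)
    · refine ⟨⟨subset_union_right, hi₂⟩, fun V' hV' hle => ?_⟩
      exact (key V' hV'.1 hV'.2).resolve_left fun h => h₂₁ (hle.trans h)

end AnalyticSubset

/-! ### Topology of the complex projective line -/

namespace ComplexProjectiveLine

/-- Proportionality as the vanishing of a determinant: a closed condition, as the Hausdorff property
requires. -/
theorem mk_eq_mk_iff_mul (v w : {v : Fin 2 → ℂ // v ≠ 0}) :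
    mk v = mk w ↔ v.1 0 * w.1 1 = v.1 1 * w.1 0 := by
  rw [mk_eq_mk_iff]
  constructor
  · rintro ⟨a, ha⟩
    simp only [← ha, Pi.smul_apply, smul_eq_mul]
    ring
  · intro h
    by_cases hw : w.1 0 = 0
    · have hw1 : w.1 1 ≠ 0 := fun h1 => w.2 (funext fun i => by fin_cases i <;> simp [hw, h1])
      have hv : v.1 0 = 0 := by simpa [hw, hw1] using h
      refine ⟨v.1 1 / w.1 1, funext fun i => ?_⟩
      fin_cases i
      · simp [hw, hv]
      · simp [hw1]
    · refine ⟨v.1 0 / w.1 0, funext fun i => ?_⟩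
      fin_cases i
      · simp [hw]
      · simp only [Fin.mk_one, Pi.smul_apply, smul_eq_mul]
        field_simp
        linear_combination h

/-- The saturation of an open set is open because scaling by a nonzero constant is continuous.
Openness lets the Hausdorff property be read off from the closed graph of the equivalence relation.
-/
theorem isOpenQuotientMap_mk : IsOpenQuotientMap mk where
  surjective := isQuotientMap_mk.surjective
  continuous := isQuotientMap_mk.continuous
  isOpenMap U hU := by
    rw [← isQuotientMap_mk.isOpen_preimage, isOpen_iff_mem_nhds]
    rintro v ⟨w, hw, hwv⟩
    obtain ⟨a, ha⟩ := (mk_eq_mk_iff w v).1 hwv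
    have ha0 : a ≠ 0 := by
      rintro rfl
      exact w.2 (by simpa using ha.symm)
    let s : {v : Fin 2 → ℂ // v ≠ 0} → {v : Fin 2 → ℂ // v ≠ 0} :=
      fun u => ⟨a • u.1, smul_ne_zero ha0 u.2⟩
    have hs : Continuous s := (continuous_subtype_val.const_smul a).subtype_mk _
    have hv : s v = w := Subtype.ext ha
    filter_upwards [(hU.preimage hs).mem_nhds (show s v ∈ U from hv ▸ hw)] with u hu
    exact ⟨s u, hu, (mk_eq_mk_iff _ _).2 ⟨a, rfl⟩⟩

instance : T2Space ComplexProjectiveLine := by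
  rw [t2Space_iff_of_isOpenQuotientMap isOpenQuotientMap_mk]
  simp only [mk_eq_mk_iff_mul]
  have h (i : Fin 2) : Continuous fun v : {v : Fin 2 → ℂ // v ≠ 0} => v.1 i :=
    (continuous_apply i).comp continuous_subtype_val
  exact isClosed_eq (((h 0).comp continuous_fst).mul ((h 1).comp continuous_snd))
    (((h 1).comp continuous_fst).mul ((h 0).comp continuous_snd))

instance : ConnectedSpace ComplexProjectiveLine := by
  -- Removing a point from a real vector space of dimension greater than one leaves it connected;
  -- here the dimension is 4.
  have hr : 1 < Module.rank ℝ (Fin 2 → ℂ) := by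
    have : Module.finrank ℝ (Fin 2 → ℂ) = 4 := by
      rw [Module.finrank_pi_fintype]
      simp [Complex.finrank_real_complex]
    rw [← Module.finrank_eq_rank, this]
    norm_num
  have := isConnected_iff_connectedSpace.1 (isConnected_compl_singleton_of_one_lt_rank hr 0)
  have : ConnectedSpace {v : Fin 2 → ℂ // v ≠ 0} := this
  exact isQuotientMap_mk.surjective.connectedSpace isQuotientMap_mk.continuous

theorem affineChart_mem_maximalAtlas (i : Fin 2) :
    affineChart i ∈ IsManifold.maximalAtlas 𝓘(ℂ, ℂ) ω ComplexProjectiveLine :=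
  IsManifold.subset_maximalAtlas (mem_range_self i)

theorem mk_affineVec_ratio {i : Fin 2} {l : ComplexProjectiveLine} (hl : l ∈ nonvanishing i) :
    mk (affineVec i (ratio i l)) = l :=
  (affineChart i).left_inv hl

theorem ratio_mk_affineVec (i : Fin 2) (t : ℂ) : ratio i (mk (affineVec i t)) = t :=
  (affineChart i).right_inv (mem_univ t)

theorem mk_affineVec_mem (i : Fin 2) (t : ℂ) : mk (affineVec i t) ∈ nonvanishing i :=
  (affineChart i).map_target (mem_univ t)

theorem contMDiffOn_ratio (i : Fin 2) :
    ContMDiffOn 𝓘(ℂ, ℂ) 𝓘(ℂ, ℂ) ω (ratio i) (nonvanishing i) :=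
  contMDiffOn_of_mem_maximalAtlas (affineChart_mem_maximalAtlas i)

theorem contMDiff_mk_affineVec (i : Fin 2) :
    ContMDiff 𝓘(ℂ, ℂ) 𝓘(ℂ, ℂ) ω fun t => mk (affineVec i t) :=
  contMDiffOn_univ.1 (contMDiffOn_symm_of_mem_maximalAtlas (affineChart_mem_maximalAtlas i))

end ComplexProjectiveLine

/-! ### Immersions and connectedness -/

section Immersion

/-- A complement of the range puts `L` in the normal form `u ↦ (u, 0)` used to define immersions. -/
theorem exists_continuousLinearEquiv_of_injective {E E' : Type*} [NormedAddCommGroup E]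
    [NormedSpace ℂ E] [NormedAddCommGroup E'] [NormedSpace ℂ E'] [FiniteDimensional ℂ E']
    (L : E →ₗ[ℂ] E') (hL : Function.Injective L) :
    ∃ (F : Submodule ℂ E') (e : (E × F) ≃L[ℂ] E'), ∀ u, e (u, 0) = L u := by
  obtain ⟨F, hF⟩ := (LinearMap.range L).exists_isCompl
  have : FiniteDimensional ℂ E := FiniteDimensional.of_injective L hL
  let e := ((LinearEquiv.ofInjective L hL).prodCongr (LinearEquiv.refl ℂ F)).trans
    (Submodule.prodEquivOfIsCompl _ F hF)
  refine ⟨F, e.toContinuousLinearEquiv, fun u => ?_⟩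
  change e (u, 0) = L u
  simp [e]

variable {E : Type*} [NormedAddCommGroup E] [NormedSpace ℂ E] {H : Type*} [TopologicalSpace H]
  {I : ModelWithCorners ℂ E H} {M : Type*} [TopologicalSpace M] [ChartedSpace H M]
  {E' : Type*} [NormedAddCommGroup E'] [NormedSpace ℂ E'] {H' : Type*} [TopologicalSpace H']
  {I' : ModelWithCorners ℂ E' H'} {N : Type*} [TopologicalSpace N] [ChartedSpace H' N]

theorem subtypeRestr_mem_maximalAtlas [IsManifold I ω M] {e : OpenPartialHomeomorph M H}
    (he : e ∈ IsManifold.maximalAtlas I ω M) {V : TopologicalSpace.Opens M} (hV : Nonempty V) :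
    e.subtypeRestr hV ∈ IsManifold.maximalAtlas I ω V := by
  refine (e.subtypeRestr hV).mem_maximalAtlas_of_contMDiffOn ?_ fun u hu => ?_
  · refine (contMDiffOn_of_mem_maximalAtlas he).comp contMDiff_subtype_val.contMDiffOn fun y hy => ?_
    rwa [OpenPartialHomeomorph.subtypeRestr_source] at hy
  · refine ContMDiffAt.contMDiffWithinAt ?_
    -- Holomorphy of a continuous map into `V` can be tested after the inclusion into `M`, an
    -- immersion.
    refine (ContMDiffAt.iff_comp_isImmersionAt
      ((IsSmoothEmbedding.of_opens V).isImmersion.isImmersionAt _)).2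
      ⟨(e.subtypeRestr hV).symm.continuousAt hu, ?_⟩
    refine (contMDiffAt_symm_of_mem_maximalAtlas he
      (e.subtypeRestr_target_subset hV hu)).congr_of_eventuallyEq ?_
    filter_upwards [(e.subtypeRestr hV).open_target.mem_nhds hu] with v hv
    exact e.subtypeRestr_symm_apply hV hv

/-- A map which is given, in suitable charts, by a fixed injective linear map is an immersion. -/
theorem isImmersion_of_linear_in_charts [FiniteDimensional ℂ E'] {f : M → N} (L : E →ₗ[ℂ] E')
    (hL : Function.Injective L)
    (h : ∀ x, ∃ c ∈ IsManifold.maximalAtlas I ω M, ∃ d ∈ IsManifold.maximalAtlas I' ω N,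
      x ∈ c.source ∧ ∀ y ∈ c.source, f y ∈ d.source ∧ I' (d (f y)) = L (I (c y))) :
    IsImmersion I I' ω f := by
  obtain ⟨F, e, he⟩ := exists_continuousLinearEquiv_of_injective L hL
  have : IsImmersionOfComplement F I I' ω f := by
    intro x
    obtain ⟨c, hc, d, hd, hx, hcd⟩ := h x
    refine IsImmersionAtOfComplement.mk_of_charts e c d hx (hcd x hx).1 hc hd
      (fun y hy => (hcd y hy).1) fun u hu => ?_
    have hu' : (c.extend I).symm u ∈ c.source := by
      rw [← c.extend_source (I := I)]
      exact (c.extend I).map_target hu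
    have h2 : I (c ((c.extend I).symm u)) = u := (c.extend I).right_inv hu
    change I' (d (f ((c.extend I).symm u))) = e (u, 0)
    rw [he, (hcd _ hu').2, h2]
  exact this.isImmersion

theorem isSmoothEmbedding_diagonal [FiniteDimensional ℂ E] [IsManifold I ω M] :
    IsSmoothEmbedding I (I.prod I) ω (fun x : M => (x, x)) where
  isImmersion := by
    refine isImmersion_of_linear_in_charts (LinearMap.id.prod LinearMap.id)
      (fun x y h => congrArg Prod.fst h) fun x => ?_
    refine ⟨chartAt H x, IsManifold.chart_mem_maximalAtlas x, (chartAt H x).prod (chartAt H x),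
      IsManifold.mem_maximalAtlas_prod (IsManifold.chart_mem_maximalAtlas x)
        (IsManifold.chart_mem_maximalAtlas x), mem_chart_source H x, fun y hy => ⟨⟨hy, hy⟩, rfl⟩⟩
  isEmbedding := .of_leftInverse (f := Prod.fst) (fun _ => rfl) continuous_fst (by fun_prop)

end Immersion

/-- A map is inducing if it has an inducing composition with a map that is continuous at all its
values. -/
theorem Topology.IsInducing.of_comp_continuousAt {A B C : Type*} [TopologicalSpace A]
    [TopologicalSpace B] [TopologicalSpace C] {f : A → B} {g : B → C} (hf : Continuous f)
    (hg : ∀ a, ContinuousAt g (f a)) (h : IsInducing (g ∘ f)) : IsInducing f := by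
  refine isInducing_iff_nhds.2 fun a => le_antisymm (hf.tendsto a).le_comap ?_
  rw [h.nhds_eq_comap a, ← Filter.comap_comap]
  exact Filter.comap_mono (hg a).tendsto.le_comap

/-- A space over a connected base, all of whose fibers are nonempty, is connected if the parts over
arbitrarily small neighborhoods are. -/
theorem PreconnectedSpace.of_isPreconnected_preimage {A B : Type*} [TopologicalSpace A]
    [TopologicalSpace B] [PreconnectedSpace B] {f : A → B} (hf : Function.Surjective f)
    (h : ∀ b, ∃ V : Set B, IsOpen V ∧ b ∈ V ∧ IsPreconnected (f ⁻¹' V)) : PreconnectedSpace A := by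
  rw [preconnectedSpace_iff_clopen]
  intro S hS
  by_contra! hne
  -- Each small preimage lies wholly in `S` or in `Sᶜ`, so `T S` and `T Sᶜ` are open and cover `B`;
  -- nonempty fibers make them disjoint.
  let T (S : Set A) : Set B := {b | ∃ V : Set B, IsOpen V ∧ b ∈ V ∧ f ⁻¹' V ⊆ S}
  have hT (S : Set A) : IsOpen (T S) := by
    rw [isOpen_iff_forall_mem_open]
    rintro b ⟨V, hV, hb, hVS⟩
    exact ⟨V, fun c hc => ⟨V, hV, hc, hVS⟩, hV, hb⟩
  have hunion (b : B) : b ∈ T S ∨ b ∈ T Sᶜ := by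
    obtain ⟨V, hV, hb, hc⟩ := h b
    rcases (f ⁻¹' V ∩ S).eq_empty_or_nonempty with he | he
    · exact Or.inr ⟨V, hV, hb, fun x hx hxS => (he ▸ ⟨hx, hxS⟩ : x ∈ (∅ : Set A))⟩
    · exact Or.inl ⟨V, hV, hb, hc.subset_isClopen hS he⟩
  have hdisj (b : B) (h1 : b ∈ T S) (h2 : b ∈ T Sᶜ) : False := by
    obtain ⟨V, -, hb, hV⟩ := h1
    obtain ⟨V', -, hb', hV'⟩ := h2
    obtain ⟨a, rfl⟩ := hf b
    exact hV' hb' (hV hb)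
  have hcompl : (T S)ᶜ = T Sᶜ := by
    ext b
    exact ⟨fun hb => (hunion b).resolve_left hb, fun h2 h1 => hdisj b h1 h2⟩
  have hclopen : IsClopen (T S) := ⟨⟨hcompl ▸ hT Sᶜ⟩, hT S⟩
  rcases isClopen_iff.1 hclopen with he | he
  · obtain ⟨a, ha⟩ := hne.1
    have : f a ∈ T Sᶜ := (hunion (f a)).resolve_left (by simp [he])
    obtain ⟨V, -, hb, hV⟩ := this
    exact hV hb ha
  · refine hne.2 (eq_univ_of_forall fun a => ?_)
    obtain ⟨V, -, hb, hV⟩ : f a ∈ T S := he ▸ mem_univ _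
    exact hV hb

/-! ### Affine coordinates of the local blow-up -/

namespace LocalBlowUp

open ComplexProjectiveLine

variable {m : ℕ}

/-- The vector with the two coordinates `a`, `b` followed by the coordinates of `z`. -/
def join (a b : ℂ) (z : Fin m → ℂ) : Fin (m + 2) → ℂ := Matrix.vecCons a (Matrix.vecCons b z)

/-- All coordinates but the first two. -/
def tail (u : Fin (m + 2) → ℂ) : Fin m → ℂ := fun k => u k.succ.succ

@[simp] theorem join_zero (a b : ℂ) (z : Fin m → ℂ) : join a b z 0 = a := rfl

@[simp] theorem join_one (a b : ℂ) (z : Fin m → ℂ) : join a b z 1 = b := rfl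

@[simp] theorem tail_join (a b : ℂ) (z : Fin m → ℂ) : tail (join a b z) = z := rfl

theorem join_tail (u : Fin (m + 2) → ℂ) : join (u 0) (u 1) (tail u) = u := by
  funext k
  refine Fin.cases rfl (fun k => Fin.cases rfl (fun k => rfl) k) k

theorem contDiff_tail : ContDiff ℂ ω (tail (m := m)) :=
  contDiff_pi.2 fun k => contDiff_apply ℂ ℂ k.succ.succ

theorem contDiff_join {F : Type*} [NormedAddCommGroup F] [NormedSpace ℂ F] {a b : F → ℂ}
    {z : F → Fin m → ℂ} (ha : ContDiff ℂ ω a) (hb : ContDiff ℂ ω b) (hz : ContDiff ℂ ω z) :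
    ContDiff ℂ ω fun x => join (a x) (b x) (z x) := by
  refine contDiff_pi.2 fun k => Fin.cases ha (fun k => Fin.cases hb (fun k => ?_) k) k
  exact contDiff_pi.1 hz k

/-- Another choice of homogeneous coordinates only multiplies the equation by a scalar. -/
theorem mem_localBlowUp_iff (z : Fin (m + 2) → ℂ) (v : {v : Fin 2 → ℂ // v ≠ 0}) :
    (z, mk v) ∈ localBlowUp m ↔ z 0 * v.1 1 = z 1 * v.1 0 := by
  constructor
  · rintro ⟨w, hw, h⟩
    obtain ⟨a, ha⟩ := (mk_eq_mk_iff v w).1 hw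
    simp only [← ha, Pi.smul_apply, smul_eq_mul]
    linear_combination a * h
  · exact fun h => ⟨v, rfl, h⟩

theorem mem_localBlowUp_of_eq_zero {z : Fin (m + 2) → ℂ} (h0 : z 0 = 0) (h1 : z 1 = 0)
    (l : ComplexProjectiveLine) : (z, l) ∈ localBlowUp m := by
  obtain ⟨v, rfl⟩ := isQuotientMap_mk.surjective l
  rw [mem_localBlowUp_iff, h0, h1, zero_mul, zero_mul]

/-- The affine parametrization of the part of the local blow-up over the `i`-th affine chart of the
projective line. -/
noncomputable def param (i : Fin 2) (u : Fin (m + 2) → ℂ) :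
    (Fin (m + 2) → ℂ) × ComplexProjectiveLine :=
  (join (u 0 * (affineVec i (u 1)).1 0) (u 0 * (affineVec i (u 1)).1 1) (tail u),
    mk (affineVec i (u 1)))

/-- The affine coordinates on the part of the local blow-up over the `i`-th affine chart of the
projective line. -/
noncomputable def coord (i : Fin 2) (p : (Fin (m + 2) → ℂ) × ComplexProjectiveLine) :
    Fin (m + 2) → ℂ :=
  join (![p.1 0, p.1 1] i) (ratio i p.2) (tail p.1)

theorem param_mem (i : Fin 2) (u : Fin (m + 2) → ℂ) : param i u ∈ localBlowUp m := by
  rw [param, mem_localBlowUp_iff, join_zero, join_one]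
  ring

/-- Here `u 0` is the coordinate `z i`, which cuts out the exceptional divisor, and `u 1` is the
affine coordinate of the line; the remaining `z`-coordinate is their product. -/
theorem coord_param (i : Fin 2) (u : Fin (m + 2) → ℂ) : coord i (param i u) = u := by
  refine Eq.trans ?_ (join_tail u)
  rw [coord, param, ratio_mk_affineVec]
  congr 1
  fin_cases i <;> simp [affineVec]

theorem param_coord {i : Fin 2} {p : (Fin (m + 2) → ℂ) × ComplexProjectiveLine}
    (hp : p ∈ localBlowUp m) (hi : p.2 ∈ nonvanishing i) : param i (coord i p) = p := by
  obtain ⟨z, l⟩ := p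
  have hl : mk (affineVec i (ratio i l)) = l := mk_affineVec_ratio hi
  rw [← hl, mem_localBlowUp_iff] at hp
  refine Prod.ext ?_ hl
  refine Eq.trans ?_ (join_tail z)
  change join _ _ (tail z) = _
  congr 1 <;> fin_cases i <;> simp [affineVec, coord] at hp ⊢
  · exact hp.symm
  · exact hp

theorem contDiff_affineVec (i j : Fin 2) : ContDiff ℂ ω fun t => (affineVec i t).1 j := by
  by_cases h : j = i
  · simp only [affineVec, h, if_true]
    exact contDiff_const
  · simp only [affineVec, h, if_false]
    exact contDiff_id

theorem contDiff_param_fst (i : Fin 2) : ContDiff ℂ ω fun u : Fin (m + 2) → ℂ => (param i u).1 := by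
  have h (j : Fin 2) : ContDiff ℂ ω fun u : Fin (m + 2) → ℂ => u 0 * (affineVec i (u 1)).1 j :=
    (contDiff_apply ℂ ℂ 0).mul ((contDiff_affineVec i j).comp (contDiff_apply ℂ ℂ 1))
  exact contDiff_join (h 0) (h 1) contDiff_tail

theorem contMDiff_param (i : Fin 2) : ContMDiff 𝓘(ℂ, Fin (m + 2) → ℂ)
    (𝓘(ℂ, Fin (m + 2) → ℂ).prod 𝓘(ℂ, ℂ)) ω (param (m := m) i) :=
  (contDiff_param_fst i).contMDiff.prodMk
    ((contMDiff_mk_affineVec i).comp (contDiff_apply ℂ ℂ 1).contMDiff)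

theorem contMDiffOn_coord (i : Fin 2) : ContMDiffOn (𝓘(ℂ, Fin (m + 2) → ℂ).prod 𝓘(ℂ, ℂ))
    𝓘(ℂ, Fin (m + 2) → ℂ) ω (coord (m := m) i) {p | p.2 ∈ nonvanishing i} := by
  have h1 : ContDiff ℂ ω fun q : (Fin (m + 2) → ℂ) × ℂ =>
      join (![q.1 0, q.1 1] i) q.2 (tail q.1) := by
    have h (k : Fin (m + 2)) : ContDiff ℂ ω fun q : (Fin (m + 2) → ℂ) × ℂ => q.1 k :=
      (contDiff_apply ℂ ℂ k).comp contDiff_fst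
    refine contDiff_join ?_ contDiff_snd (contDiff_tail.comp contDiff_fst)
    fin_cases i
    · exact h 0
    · exact h 1
  have h2 : ContMDiffOn (𝓘(ℂ, Fin (m + 2) → ℂ).prod 𝓘(ℂ, ℂ)) 𝓘(ℂ, (Fin (m + 2) → ℂ) × ℂ) ω
      (fun p : (Fin (m + 2) → ℂ) × ComplexProjectiveLine => (p.1, ratio i p.2))
      {p | p.2 ∈ nonvanishing i} :=
    contMDiffOn_fst.prodMk_space ((contMDiffOn_ratio i).comp contMDiffOn_snd fun p hp => hp)
  exact h1.contMDiff.comp_contMDiffOn h2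

/-- The part of the local blow-up over a ball around a point of the center is connected. -/
theorem isPreconnected_inter_ball {a : Fin (m + 2) → ℂ} (h0 : a 0 = 0) (h1 : a 1 = 0) (r : ℝ) :
    IsPreconnected (localBlowUp m ∩ Metric.ball a r ×ˢ univ) := by
  rcases le_or_gt r 0 with hr | hr
  · simp [Metric.ball_eq_empty.2 hr, isPreconnected_empty]
  obtain ⟨l⟩ : Nonempty ComplexProjectiveLine := inferInstance
  have ha : a ∈ Metric.ball a r := Metric.mem_ball_self hr
  refine isPreconnected_of_forall (a, l) fun p hp => ?_
  obtain ⟨⟨v, hpv, hv⟩, hpr, -⟩ := hp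
  -- Contract the base point to `a` with the line kept fixed, which preserves the equation as it is
  -- homogeneous in `z 0, z 1`; then move inside the full projective line over `a`.
  refine ⟨segment ℝ a p.1 ×ˢ {p.2} ∪ {a} ×ˢ univ, ?_, Or.inr ⟨rfl, mem_univ _⟩,
    Or.inl ⟨right_mem_segment ℝ a p.1, rfl⟩, ?_⟩
  · rintro ⟨z, l'⟩ (⟨hz, hl⟩ | ⟨hz, -⟩)
    · refine ⟨?_, (convex_ball a r).segment_subset ha hpr hz, mem_univ _⟩
      obtain ⟨c, d, -, -, -, rfl⟩ := hz
      obtain rfl : l' = p.2 := hl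
      rw [hpv, mem_localBlowUp_iff]
      simp only [Pi.add_apply, Pi.smul_apply, Complex.real_smul, h0, h1]
      linear_combination (d : ℂ) * hv
    · obtain rfl : z = a := hz
      exact ⟨mem_localBlowUp_of_eq_zero h0 h1 l', ha, mem_univ _⟩
  · exact ((convex_segment a p.1).isPreconnected.prod isPreconnected_singleton).union (a, p.2)
      ⟨left_mem_segment ℝ a p.1, rfl⟩ ⟨rfl, mem_univ _⟩
      (isPreconnected_singleton.prod isPreconnected_univ)

end LocalBlowUp

/-! ### Local structure of a blow-up -/

/-- `H` is an inverse of the identification `w ↦ (φ (π w), g w)` of the part of the blow-up `W` of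
`X` over the domain of the coordinate patch `φ` with a part of the local blow-up. -/
structure IsLocalBlowUpChart {m : ℕ}
    {X : Type*} [TopologicalSpace X] [ChartedSpace (Fin (m + 2) → ℂ) X]
    {W : Type*} [TopologicalSpace W] [ChartedSpace (Fin (m + 2) → ℂ) W]
    (π : W → X) (Y : Set X) (φ : OpenPartialHomeomorph X (Fin (m + 2) → ℂ))
    (g : W → ComplexProjectiveLine) (H : (Fin (m + 2) → ℂ) × ComplexProjectiveLine → W) :
    Prop where
  adapted : IsAdaptedChart Y φ
  contMDiff_proj : ContMDiff 𝓘(ℂ, Fin (m + 2) → ℂ) 𝓘(ℂ, Fin (m + 2) → ℂ) ω π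
  contMDiffOn_line : ContMDiffOn 𝓘(ℂ, Fin (m + 2) → ℂ) 𝓘(ℂ, ℂ) ω g (π ⁻¹' φ.source)
  mem : ∀ w, π w ∈ φ.source → (φ (π w), g w) ∈ localBlowUp m
  left_inv : ∀ w, π w ∈ φ.source → H (φ (π w), g w) = w
  right_inv : ∀ p ∈ localBlowUp m, p.1 ∈ φ.target →
    π (H p) ∈ φ.source ∧ φ (π (H p)) = p.1 ∧ g (H p) = p.2
  continuousOn : ContinuousOn H (localBlowUp m ∩ φ.target ×ˢ univ)
  -- The local blow-up is only a subset of the product, so holomorphy of `H` is expressed through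
  -- its affine parametrizations.
  contMDiffOn_param : ∀ i, ContMDiffOn 𝓘(ℂ, Fin (m + 2) → ℂ) 𝓘(ℂ, Fin (m + 2) → ℂ) ω
    (fun u => H (LocalBlowUp.param i u)) {u | (LocalBlowUp.param i u).1 ∈ φ.target}

section BlowUp

open LocalBlowUp ComplexProjectiveLine

variable {m : ℕ} {X : Type*} [TopologicalSpace X] [ChartedSpace (Fin (m + 2) → ℂ) X]
  {W : Type*} [TopologicalSpace W] [ChartedSpace (Fin (m + 2) → ℂ) W]
  {π : W → X} {Y : Set X}

namespace IsLocalBlowUpChart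

variable {φ : OpenPartialHomeomorph X (Fin (m + 2) → ℂ)} {g : W → ComplexProjectiveLine}
  {H : (Fin (m + 2) → ℂ) × ComplexProjectiveLine → W}

theorem isOpen_preimage_source (h : IsLocalBlowUpChart π Y φ g H) : IsOpen (π ⁻¹' φ.source) :=
  φ.open_source.preimage h.contMDiff_proj.continuous

theorem contMDiffOn_comp_proj (h : IsLocalBlowUpChart π Y φ g H) :
    ContMDiffOn 𝓘(ℂ, Fin (m + 2) → ℂ) 𝓘(ℂ, Fin (m + 2) → ℂ) ω (fun w => φ (π w))
      (π ⁻¹' φ.source) :=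
  (contMDiffOn_of_mem_maximalAtlas h.adapted.1).comp h.contMDiff_proj.contMDiffOn Subset.rfl

/-- The affine coordinates on the part of the blow-up over the domain of a coordinate patch. -/
noncomputable def chart (h : IsLocalBlowUpChart π Y φ g H) (i : Fin 2) :
    OpenPartialHomeomorph W (Fin (m + 2) → ℂ) where
  toFun w := coord i (φ (π w), g w)
  invFun u := H (param i u)
  source := {w | π w ∈ φ.source ∧ g w ∈ nonvanishing i}
  target := {u | (param i u).1 ∈ φ.target}
  map_source' w hw := by
    rw [mem_ofPred_eq, param_coord (h.mem w hw.1) hw.2]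
    exact φ.map_source hw.1
  map_target' u hu := by
    obtain ⟨h1, -, h3⟩ := h.right_inv _ (param_mem i u) hu
    exact ⟨h1, h3 ▸ mk_affineVec_mem i _⟩
  left_inv' w hw := by rw [param_coord (h.mem w hw.1) hw.2, h.left_inv w hw.1]
  right_inv' u hu := by
    obtain ⟨-, h2, h3⟩ := h.right_inv _ (param_mem i u) hu
    rw [h2, h3]
    exact coord_param i u
  open_source := h.contMDiffOn_line.continuousOn.isOpen_inter_preimage h.isOpen_preimage_source
    (isOpen_nonvanishing i)
  open_target := φ.open_target.preimage (contDiff_param_fst i).continuous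
  continuousOn_toFun := ((contMDiffOn_coord i).continuousOn.comp
    ((h.contMDiffOn_comp_proj.prodMk h.contMDiffOn_line).continuousOn.mono fun _ hw => hw.1)
    fun _ hw => hw.2)
  continuousOn_invFun := (h.contMDiffOn_param i).continuousOn

theorem chart_mem_maximalAtlas [IsManifold 𝓘(ℂ, Fin (m + 2) → ℂ) ω W]
    (h : IsLocalBlowUpChart π Y φ g H) (i : Fin 2) :
    h.chart i ∈ IsManifold.maximalAtlas 𝓘(ℂ, Fin (m + 2) → ℂ) ω W :=
  (h.chart i).mem_maximalAtlas_of_contMDiffOn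
    ((contMDiffOn_coord i).comp ((h.contMDiffOn_comp_proj.prodMk h.contMDiffOn_line).mono
      fun _ hw => hw.1) fun _ hw => hw.2)
    (h.contMDiffOn_param i)

/-- The part of the blow-up over a small neighborhood of a point of the center is connected. -/
theorem exists_isPreconnected_preimage (h : IsLocalBlowUpChart π Y φ g H) {y : X} (hy : y ∈ Y)
    (hyφ : y ∈ φ.source) : ∃ V : Set X, IsOpen V ∧ y ∈ V ∧ IsPreconnected (π ⁻¹' V) := by
  obtain ⟨h0, h1⟩ := (h.adapted.2 y hyφ).1 hy
  obtain ⟨r, hr, hball⟩ := Metric.isOpen_iff.1 φ.open_target _ (φ.map_source hyφ)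
  refine ⟨φ.source ∩ φ ⁻¹' Metric.ball (φ y) r, φ.isOpen_inter_preimage Metric.isOpen_ball,
    ⟨hyφ, Metric.mem_ball_self hr⟩, ?_⟩
  have : π ⁻¹' (φ.source ∩ φ ⁻¹' Metric.ball (φ y) r) =
      H '' (localBlowUp m ∩ Metric.ball (φ y) r ×ˢ univ) := by
    ext w
    constructor
    · rintro ⟨hw, hwr⟩
      exact ⟨_, ⟨h.mem w hw, hwr, mem_univ _⟩, h.left_inv w hw⟩
    · rintro ⟨p, ⟨hp, hpr, -⟩, rfl⟩
      obtain ⟨h1, h2, -⟩ := h.right_inv p hp (hball hpr)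
      exact ⟨h1, by rw [mem_preimage, h2]; exact hpr⟩
  rw [this]
  exact (isPreconnected_inter_ball h0 h1 r).image H
    (h.continuousOn.mono (inter_subset_inter_right _ (prod_mono hball Subset.rfl)))

end IsLocalBlowUpChart

namespace IsBlowUp

/-- Turns the embedding on the open subset `O` into total functions, with `g` constant outside `O`,
and its inverse on the range into a map `H` holomorphic in affine parameters. -/
theorem exists_isLocalBlowUpChart (hπ : IsBlowUp m π Y) {y : X} (hy : y ∈ Y) :
    ∃ (φ : OpenPartialHomeomorph X (Fin (m + 2) → ℂ)) (g : W → ComplexProjectiveLine)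
      (H : (Fin (m + 2) → ℂ) × ComplexProjectiveLine → W),
      y ∈ φ.source ∧ IsLocalBlowUpChart π Y φ g H := by
  obtain ⟨φ, hyφ, hφ, O, hO, g, hG, hrange⟩ := hπ.locally_eq y hy
  have hmemO (w : W) : w ∈ O ↔ π w ∈ φ.source := by rw [← SetLike.mem_coe, hO]; rfl
  set G : O → (Fin (m + 2) → ℂ) × ComplexProjectiveLine := fun w => (φ (π w), g w) with hGdef
  obtain ⟨l⟩ : Nonempty ComplexProjectiveLine := inferInstance
  have : Nonempty O := by
    obtain ⟨h0, h1⟩ := (hφ.2 y hyφ).1 hy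
    have : (φ y, l) ∈ range G := by
      rw [hrange]
      exact ⟨mem_localBlowUp_of_eq_zero h0 h1 l, φ.map_source hyφ, mem_univ _⟩
    exact ⟨this.choose⟩
  have hK {p} (hp : p ∈ localBlowUp m ∩ φ.target ×ˢ univ) : G (Function.invFun G p) = p :=
    Function.invFun_eq (by rw [← hrange] at hp; exact hp)
  have hKc : ContinuousOn (Function.invFun G) (localBlowUp m ∩ φ.target ×ˢ univ) := by
    rw [hG.isEmbedding.isInducing.continuousOn_iff]
    exact continuousOn_id.congr fun p hp => hK hp
  classical
  refine ⟨φ, fun w => if h : w ∈ O then g ⟨w, h⟩ else l, fun p => (Function.invFun G p : O), hyφ,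
    ?_⟩
  have hgO (w : O) : (if h : (w : W) ∈ O then g ⟨w, h⟩ else l) = g w := dif_pos w.2
  refine ⟨hφ, hπ.holomorphic, ?_, ?_, ?_, ?_, ?_, ?_⟩
  · intro w hw
    refine ContMDiffAt.contMDiffWithinAt ?_
    have hw' : w ∈ O := (hmemO w).2 hw
    refine (contMDiffAt_subtype_iff (U := O) (x := ⟨w, hw'⟩)).1 ?_
    simp only [hgO]
    exact (contMDiff_snd.comp hG.contMDiff).contMDiffAt
  · intro w hw
    have hw' : w ∈ O := (hmemO w).2 hw
    have : G ⟨w, hw'⟩ ∈ localBlowUp m ∩ φ.target ×ˢ univ := hrange ▸ mem_range_self _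
    rw [dif_pos hw']
    exact this.1
  · intro w hw
    have hw' : w ∈ O := (hmemO w).2 hw
    rw [dif_pos hw']
    exact congrArg Subtype.val
      (Function.leftInverse_invFun hG.isEmbedding.injective ⟨w, hw'⟩)
  · intro p hp hpt
    have h1 := hK ⟨hp, hpt, mem_univ _⟩
    refine ⟨(hmemO _).1 (Function.invFun G p).2, congrArg Prod.fst h1, ?_⟩
    rw [hgO]
    exact congrArg Prod.snd h1
  · exact continuous_subtype_val.comp_continuousOn hKc
  · intro i u hu
    have hopen : IsOpen {u : Fin (m + 2) → ℂ | (param i u).1 ∈ φ.target} :=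
      φ.open_target.preimage (contDiff_param_fst i).continuous
    have hmaps : MapsTo (param i) {u : Fin (m + 2) → ℂ | (param i u).1 ∈ φ.target}
        (localBlowUp m ∩ φ.target ×ˢ univ) := fun u hu => ⟨param_mem i u, hu, mem_univ _⟩
    refine ContMDiffAt.contMDiffWithinAt ?_
    refine contMDiff_subtype_val.contMDiffAt.comp u
      (g := Subtype.val) (f := fun u => Function.invFun G (param i u)) ?_
    -- Composing with the immersion `G` turns the inverse map into `param i`, which is holomorphic.
    refine (ContMDiffAt.iff_comp_isImmersionAt (hG.isImmersion.isImmersionAt _)).2 ⟨?_, ?_⟩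
    · exact (hKc.comp (contMDiff_param i).continuous.continuousOn hmaps).continuousAt
        (hopen.mem_nhds hu)
    · refine (contMDiff_param i).contMDiffAt.congr_of_eventuallyEq ?_
      filter_upwards [hopen.mem_nhds hu] with v hv
      exact hK (hmaps hv)

theorem surjective (hπ : IsBlowUp m π Y) : Function.Surjective π := by
  intro x
  by_cases hx : x ∈ Y
  · obtain ⟨φ, g, H, hxφ, h⟩ := hπ.exists_isLocalBlowUpChart hx
    obtain ⟨h0, h1⟩ := (h.adapted.2 x hxφ).1 hx
    obtain ⟨l⟩ : Nonempty ComplexProjectiveLine := inferInstance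
    obtain ⟨h2, h3, -⟩ := h.right_inv (φ x, l) (mem_localBlowUp_of_eq_zero h0 h1 l)
      (φ.map_source hxφ)
    exact ⟨_, φ.injOn h2 hxφ h3⟩
  · obtain ⟨w, -, hw⟩ := hπ.bijOn.surjOn hx
    exact ⟨w, hw⟩

/-- Points with different images are separated in `X`; distinct points over the same point of `Y`
are separated by `g`; over other points `π` is injective. -/
theorem t2Space [T2Space X] (hπ : IsBlowUp m π Y) : T2Space W := by
  refine ⟨fun w w' hne => ?_⟩
  by_cases hw : π w = π w'
  · by_cases hY : π w ∈ Y
    · obtain ⟨φ, g, H, hφ, h⟩ := hπ.exists_isLocalBlowUpChart hY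
      have hφ' : π w' ∈ φ.source := hw ▸ hφ
      have hg : g w ≠ g w' := fun hg => hne <| by
        rw [← h.left_inv w hφ, ← h.left_inv w' hφ', hw, hg]
      obtain ⟨u, v, hu, hv, hwu, hwv, huv⟩ := t2_separation hg
      have ho {u : Set ComplexProjectiveLine} (hu : IsOpen u) :=
        h.contMDiffOn_line.continuousOn.isOpen_inter_preimage h.isOpen_preimage_source hu
      exact ⟨_, _, ho hu, ho hv, ⟨hφ, hwu⟩, ⟨hφ', hwv⟩,
        (huv.preimage g).mono inter_subset_right inter_subset_right⟩
    · exact absurd (hπ.bijOn.injOn hY (hw ▸ hY : π w' ∉ Y) hw) hne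
  · exact separated_by_continuous hπ.holomorphic.continuous hw

/-- Small pieces over points of `Y` are connected by the local model, and elsewhere by local
biholomorphy; the connected base glues them. -/
theorem connectedSpace [ConnectedSpace X] (hπ : IsBlowUp m π Y) (hY : IsClosed Y) :
    ConnectedSpace W := by
  have : Nonempty W := hπ.surjective.nonempty
  have : LocallyConnectedSpace X := ChartedSpace.locallyConnectedSpace (Fin (m + 2) → ℂ) X
  have : PreconnectedSpace W := by
    refine .of_isPreconnected_preimage hπ.surjective fun x => ?_
    by_cases hx : x ∈ Y
    · obtain ⟨φ, g, H, hxφ, h⟩ := hπ.exists_isLocalBlowUpChart hx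
      exact h.exists_isPreconnected_preimage hx hxφ
    · obtain ⟨w, -, rfl⟩ := hπ.bijOn.surjOn hx
      obtain ⟨Φ, hw, hΦ⟩ := hπ.isLocalDiffeomorphAt w hx
      have hmem : Φ.target ∩ Yᶜ ∈ 𝓝 (π w) :=
        (Φ.open_target.inter hY.isOpen_compl).mem_nhds ⟨by rw [hΦ hw]; exact Φ.map_source hw, hx⟩
      obtain ⟨V, hVs, hV, hwV, hVc⟩ :=
        locallyConnectedSpace_iff_subsets_isOpen_isConnected.1 this _ _ hmem
      refine ⟨V, hV, hwV, ?_⟩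
      have hinv {x} (hx : x ∈ V) : π (Φ.toPartialEquiv.symm x) = x := by
        rw [hΦ (Φ.map_target (hVs hx).1)]
        exact Φ.right_inv (hVs hx).1
      -- Injectivity of `π` off the center shows that the local inverse catches every point over
      -- `V`.
      have : π ⁻¹' V = Φ.toPartialEquiv.symm '' V := by
        ext w'
        constructor
        · intro hw'
          refine ⟨π w', hw', hπ.bijOn.injOn ?_ (hVs hw').2 (hinv hw')⟩
          rw [mem_preimage, hinv hw']
          exact (hVs hw').2
        · rintro ⟨x, hx, rfl⟩
          rw [mem_preimage, hinv hx]
          exact hx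
      rw [this]
      exact hVc.isPreconnected.image _ (Φ.contMDiffOn_invFun.continuousOn.mono fun x hx => (hVs hx).1)
  exact ⟨inferInstance⟩

theorem isAnalyticSubset_center (hπ : IsBlowUp m π Y) (hY : IsClosed Y) :
    IsAnalyticSubset 𝓘(ℂ, Fin (m + 2) → ℂ) Y := by
  refine .of_isClosed hY fun y hy => ?_
  obtain ⟨φ, g, H, hyφ, h⟩ := hπ.exists_isLocalBlowUpChart hy
  have hL : ContDiff ℂ ω fun u : Fin (m + 2) → ℂ => ![u 0, u 1] := by
    refine contDiff_pi.2 (Fin.forall_fin_two.2 ⟨?_, ?_⟩)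
    · exact contDiff_apply ℂ ℂ 0
    · exact contDiff_apply ℂ ℂ 1
  refine ⟨φ.source, φ.open_source, hyφ, 2, fun x => ![φ x 0, φ x 1],
    hL.contMDiff.comp_contMDiffOn (contMDiffOn_of_mem_maximalAtlas h.adapted.1), fun x hx => ?_⟩
  rw [h.adapted.2 x hx]
  simp

theorem exists_notMem_center (hπ : IsBlowUp m π Y) (hne : Y.Nonempty) : ∃ x, x ∉ Y := by
  obtain ⟨y, hy⟩ := hne
  obtain ⟨φ, g, H, hyφ, h⟩ := hπ.exists_isLocalBlowUpChart hy
  -- A small displacement in the first normal direction leaves the center.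
  let e : Fin (m + 2) → ℂ := Pi.single 0 1
  have hc : Filter.Tendsto (fun t : ℂ => φ y + t • e) (𝓝[≠] 0) (𝓝 (φ y)) := by
    have : Continuous fun t : ℂ => φ y + t • e := by fun_prop
    simpa using (this.tendsto 0).mono_left nhdsWithin_le_nhds
  obtain ⟨t, ht, ht0⟩ := ((hc.eventually (φ.open_target.mem_nhds (φ.map_source hyφ))).and
    self_mem_nhdsWithin).exists
  refine ⟨φ.symm (φ y + t • e), fun hY => ht0 ?_⟩
  have h0 := ((h.adapted.2 _ (φ.map_target ht)).1 hY).1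
  rw [φ.right_inv ht, Pi.add_apply, ((h.adapted.2 y hyφ).1 hy).1] at h0
  simpa [e] using h0

/-- If the analytic set `π ⁻¹' Y` had interior, it would be all of the connected `W`, whereas `π` is
onto and `Y` is not all of `X`. -/
theorem dense_preimage_compl [ConnectedSpace X] [IsManifold 𝓘(ℂ, Fin (m + 2) → ℂ) ω W]
    (hπ : IsBlowUp m π Y) (hY : IsClosed Y) (hne : Y.Nonempty) : Dense (π ⁻¹' Yᶜ) := by
  have := hπ.connectedSpace hY
  rw [preimage_compl, ← interior_eq_empty_iff_dense_compl, ← not_nonempty_iff_eq_empty]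
  intro hi
  have h := ((hπ.isAnalyticSubset_center hY).preimage hπ.holomorphic).eq_univ hi
  obtain ⟨x, hx⟩ := hπ.exists_notMem_center hne
  obtain ⟨w, rfl⟩ := hπ.surjective x
  exact hx (h ▸ mem_univ w : w ∈ π ⁻¹' Y)

end IsBlowUp

end BlowUp

/-! ### The exceptional part of the fibered product -/

section Bundle

open LocalBlowUp ComplexProjectiveLine

variable {m : ℕ} {X : Type*} [TopologicalSpace X] [ChartedSpace (Fin (m + 2) → ℂ) X]
  {W : Type*} [TopologicalSpace W] [ChartedSpace (Fin (m + 2) → ℂ) W] {π : W → X}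
  {Y : Type*} {ι : Y → X} {φ : OpenPartialHomeomorph X (Fin (m + 2) → ℂ)}
  {g : W → ComplexProjectiveLine} {H : (Fin (m + 2) → ℂ) × ComplexProjectiveLine → W}

theorem IsAdaptedChart.join_tail_eq (hφ : IsAdaptedChart (range ι) φ) {y : Y}
    (hy : ι y ∈ φ.source) : join 0 0 (tail (φ (ι y))) = φ (ι y) := by
  obtain ⟨h0, h1⟩ := (hφ.2 _ hy).1 (mem_range_self y)
  rw [← join_tail (φ (ι y)), h0, h1, tail_join]

theorem IsAdaptedChart.symm_join_mem (hφ : IsAdaptedChart (range ι) φ) {z : Fin m → ℂ}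
    (hz : join 0 0 z ∈ φ.target) : φ.symm (join 0 0 z) ∈ range ι := by
  rw [hφ.2 _ (φ.map_target hz), φ.right_inv hz]
  exact ⟨rfl, rfl⟩

/-- Over the center the incidence equation imposes nothing, so every line `l` occurs. -/
theorem IsLocalBlowUpChart.right_inv_of_center (h : IsLocalBlowUpChart π (range ι) φ g H) {y : Y}
    (hy : ι y ∈ φ.source) (l : ComplexProjectiveLine) :
    π (H (φ (ι y), l)) = ι y ∧ g (H (φ (ι y), l)) = l := by
  obtain ⟨h0, h1⟩ := (h.adapted.2 _ hy).1 (mem_range_self y)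
  obtain ⟨h2, h3, h4⟩ := h.right_inv (φ (ι y), l) (mem_localBlowUp_of_eq_zero h0 h1 l)
    (φ.map_source hy)
  exact ⟨φ.injOn h2 hy h3, h4⟩

variable [TopologicalSpace Y] [ChartedSpace (Fin m → ℂ) Y]

/-- The chart of an embedded submanifold of codimension 2 given by an adapted chart. -/
noncomputable def IsAdaptedChart.submanifoldChart [Nonempty Y]
    (hφ : IsAdaptedChart (range ι) φ) (hι : IsEmbedding ι) :
    OpenPartialHomeomorph Y (Fin m → ℂ) where
  toFun y := tail (φ (ι y))
  invFun z := Function.invFun ι (φ.symm (join 0 0 z))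
  source := ι ⁻¹' φ.source
  target := {z | join 0 0 z ∈ φ.target}
  map_source' y hy := by
    rw [mem_ofPred_eq, hφ.join_tail_eq hy]
    exact φ.map_source hy
  map_target' z hz := by
    rw [mem_preimage, Function.invFun_eq (hφ.symm_join_mem hz)]
    exact φ.map_target hz
  left_inv' y hy := by
    rw [hφ.join_tail_eq hy, φ.left_inv hy]
    exact Function.leftInverse_invFun hι.injective y
  right_inv' z hz := by
    rw [Function.invFun_eq (hφ.symm_join_mem hz), φ.right_inv hz, tail_join]
  open_source := φ.open_source.preimage hι.continuous
  open_target := φ.open_target.preimage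
    (contDiff_join contDiff_const contDiff_const contDiff_id).continuous
  continuousOn_toFun := contDiff_tail.continuous.comp_continuousOn
    (φ.continuousOn.comp hι.continuous.continuousOn Subset.rfl)
  continuousOn_invFun := by
    rw [hι.isInducing.continuousOn_iff]
    refine ContinuousOn.congr (f := fun z => φ.symm (join 0 0 z)) ?_
      fun z hz => Function.invFun_eq (hφ.symm_join_mem hz)
    exact φ.symm.continuousOn.comp
      (contDiff_join contDiff_const contDiff_const contDiff_id).continuous.continuousOn
      fun z hz => hz

/-- The complex structure of `Y` is given in advance; compatibility of the inverse chart follows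
because `ι` is an immersion and its composition with `ι` is holomorphic. -/
theorem IsAdaptedChart.submanifoldChart_mem_maximalAtlas [Nonempty Y]
    [IsManifold 𝓘(ℂ, Fin m → ℂ) ω Y] (hφ : IsAdaptedChart (range ι) φ)
    (hι : IsSmoothEmbedding 𝓘(ℂ, Fin m → ℂ) 𝓘(ℂ, Fin (m + 2) → ℂ) ω ι) :
    hφ.submanifoldChart hι.isEmbedding ∈ IsManifold.maximalAtlas 𝓘(ℂ, Fin m → ℂ) ω Y := by
  set η := hφ.submanifoldChart hι.isEmbedding
  have hj : ContDiff ℂ ω fun z : Fin m → ℂ => join 0 0 z :=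
    contDiff_join contDiff_const contDiff_const contDiff_id
  refine η.mem_maximalAtlas_of_contMDiffOn ?_ ?_
  · exact contDiff_tail.contMDiff.comp_contMDiffOn
      ((contMDiffOn_of_mem_maximalAtlas hφ.1).comp hι.contMDiff.contMDiffOn Subset.rfl)
  · intro z hz
    refine ContMDiffAt.contMDiffWithinAt ?_
    refine (ContMDiffAt.iff_comp_isImmersionAt (hι.isImmersion.isImmersionAt _)).2
      ⟨η.symm.continuousAt hz, ?_⟩
    have h1 : ContMDiffOn 𝓘(ℂ, Fin m → ℂ) 𝓘(ℂ, Fin (m + 2) → ℂ) ω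
        (fun z => φ.symm (join 0 0 z)) η.target :=
      (contMDiffOn_symm_of_mem_maximalAtlas hφ.1).comp hj.contMDiff.contMDiffOn fun z hz => hz
    refine (h1.contMDiffAt (η.open_target.mem_nhds hz)).congr_of_eventuallyEq ?_
    filter_upwards [η.open_target.mem_nhds hz] with u hu
    exact Function.invFun_eq (hφ.symm_join_mem hu)

/-- The linear map expressing the fibers of the fibered product in affine coordinates. -/
def affineFiberMap (m : ℕ) :
    (Fin m → ℂ) × (ℂ × ℂ) →ₗ[ℂ] (Fin (m + 2) → ℂ) × (Fin (m + 2) → ℂ) where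
  toFun p := (join 0 p.2.1 p.1, join 0 p.2.2 p.1)
  map_add' p q := by
    refine Prod.ext (funext fun k => ?_) (funext fun k => ?_) <;>
    exact Fin.cases (add_zero _).symm (fun k => Fin.cases rfl (fun k => rfl) k) k
  map_smul' a p := by
    refine Prod.ext (funext fun k => ?_) (funext fun k => ?_) <;>
    exact Fin.cases (mul_zero _).symm (fun k => Fin.cases rfl (fun k => rfl) k) k

theorem affineFiberMap_injective (m : ℕ) : Function.Injective (affineFiberMap m) := by
  rintro ⟨z, t, s⟩ ⟨z', t', s'⟩ h
  have h1 : join 0 t z = join 0 t' z' := congrArg Prod.fst h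
  have h2 : join 0 s z = join 0 s' z' := congrArg Prod.snd h
  exact Prod.ext (congrArg tail h1) (Prod.ext (congrFun h1 1) (congrFun h2 1))

/-- The local trivialization of the part of the fibered product over the center. -/
theorem IsLocalBlowUpChart.isSmoothEmbedding_trivialization [Nonempty Y]
    [IsManifold 𝓘(ℂ, Fin m → ℂ) ω Y] [IsManifold 𝓘(ℂ, Fin (m + 2) → ℂ) ω W]
    (h : IsLocalBlowUpChart π (range ι) φ g H)
    (hι : IsSmoothEmbedding 𝓘(ℂ, Fin m → ℂ) 𝓘(ℂ, Fin (m + 2) → ℂ) ω ι)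
    (V : TopologicalSpace.Opens Y) (hV : (V : Set Y) ⊆ ι ⁻¹' φ.source) :
    IsSmoothEmbedding (𝓘(ℂ, Fin m → ℂ).prod (𝓘(ℂ, ℂ).prod 𝓘(ℂ, ℂ)))
      (𝓘(ℂ, Fin (m + 2) → ℂ).prod 𝓘(ℂ, Fin (m + 2) → ℂ)) ω
      (fun p : V × (ComplexProjectiveLine × ComplexProjectiveLine) =>
        (H (φ (ι p.1), p.2.1), H (φ (ι p.1), p.2.2))) := by
  have himm : IsImmersion (𝓘(ℂ, Fin m → ℂ).prod (𝓘(ℂ, ℂ).prod 𝓘(ℂ, ℂ)))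
      (𝓘(ℂ, Fin (m + 2) → ℂ).prod 𝓘(ℂ, Fin (m + 2) → ℂ)) ω
      (fun p : V × (ComplexProjectiveLine × ComplexProjectiveLine) =>
        (H (φ (ι p.1), p.2.1), H (φ (ι p.1), p.2.2))) := by
    -- In affine charts the map is `(z, t, s) ↦ ((0, t, z), (0, s, z))`: the coordinate defining the
    -- exceptional divisor vanishes.
    refine isImmersion_of_linear_in_charts (affineFiberMap m) (affineFiberMap_injective m) ?_
    rintro ⟨y, l, l'⟩
    obtain ⟨i, hi⟩ := exists_mem_nonvanishing l
    obtain ⟨j, hj⟩ := exists_mem_nonvanishing l'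
    have hVne : Nonempty V := ⟨y⟩
    set η := h.adapted.submanifoldChart hι.isEmbedding
    refine ⟨(η.subtypeRestr hVne).prod ((affineChart i).prod (affineChart j)),
      IsManifold.mem_maximalAtlas_prod
        (subtypeRestr_mem_maximalAtlas
          (h.adapted.submanifoldChart_mem_maximalAtlas hι) hVne)
        (IsManifold.mem_maximalAtlas_prod (affineChart_mem_maximalAtlas i)
          (affineChart_mem_maximalAtlas j)),
      (h.chart i).prod (h.chart j), IsManifold.mem_maximalAtlas_prod (h.chart_mem_maximalAtlas i)
        (h.chart_mem_maximalAtlas j), ⟨?_, hi, hj⟩, ?_⟩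
    · rw [OpenPartialHomeomorph.subtypeRestr_source]
      exact hV y.2
    · rintro ⟨y, l, l'⟩ ⟨-, hl, hl'⟩
      have key (k : Fin 2) (l : ComplexProjectiveLine) (hl : l ∈ nonvanishing k) :
          H (φ (ι y), l) ∈ (h.chart k).source ∧
          h.chart k (H (φ (ι y), l)) = join 0 (ratio k l) (tail (φ (ι y))) := by
        obtain ⟨h1, h2⟩ := h.right_inv_of_center (hV y.2) l
        obtain ⟨h3, h4⟩ := (h.adapted.2 _ (hV y.2)).1 (mem_range_self _)
        refine ⟨⟨by rw [h1]; exact hV y.2, by rw [h2]; exact hl⟩, ?_⟩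
        change coord k (φ (π (H (φ (ι y), l))), g (H (φ (ι y), l))) = _
        rw [h1, h2, coord]
        congr 1
        fin_cases k
        · exact h3
        · exact h4
      exact ⟨⟨(key i l hl).1, (key j l' hl').1⟩, Prod.ext (key i l hl).2 (key j l' hl').2⟩
  -- Applying `π` and the two line coordinates recovers `(ι y, l, l')`, an embedding. Since `g` is
  -- controlled only over `φ.source`, continuity at the values taken must suffice.
  have hr : IsEmbedding (fun p : V × (ComplexProjectiveLine × ComplexProjectiveLine) =>
      (ι p.1, p.2)) := (hι.isEmbedding.comp .subtypeVal).prodMap .id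
  have hgf : (fun c : W × W => (π c.1, (g c.1, g c.2))) ∘
      (fun p : V × (ComplexProjectiveLine × ComplexProjectiveLine) =>
        (H (φ (ι p.1), p.2.1), H (φ (ι p.1), p.2.2))) = fun p => (ι p.1, p.2) := by
    funext p
    obtain ⟨h1, h2⟩ := h.right_inv_of_center (hV p.1.2) p.2.1
    obtain ⟨-, h3⟩ := h.right_inv_of_center (hV p.1.2) p.2.2
    exact Prod.ext h1 (Prod.ext h2 h3)
  refine ⟨himm, .of_comp_continuousAt (g := fun c : W × W => (π c.1, (g c.1, g c.2)))
    himm.contMDiff.continuous (fun p => ?_) (hgf ▸ hr.isInducing), ?_⟩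
  · have hg (l) : ContinuousAt g (H (φ (ι p.1), l)) := by
      refine h.contMDiffOn_line.continuousOn.continuousAt (h.isOpen_preimage_source.mem_nhds ?_)
      rw [mem_preimage, (h.right_inv_of_center (hV p.1.2) l).1]
      exact hV p.1.2
    exact (h.contMDiff_proj.continuous.continuousAt.comp continuousAt_fst).prodMk
      ((ContinuousAt.comp (f := Prod.fst) (hg _) continuousAt_fst).prodMk
        (ContinuousAt.comp (f := Prod.snd) (hg _) continuousAt_snd))
  · exact Function.Injective.of_comp (hgf ▸ hr.injective)

/-- `V` is taken connected, as the identity theorem on `V × F` requires; the inverse of `Φ` reads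
off `q` and the two line coordinates. -/
theorem IsBlowUp.exists_trivialization [Nonempty Y]
    [IsManifold 𝓘(ℂ, Fin m → ℂ) ω Y] [IsManifold 𝓘(ℂ, Fin (m + 2) → ℂ) ω W]
    (hπ : IsBlowUp m π (range ι))
    (hι : IsSmoothEmbedding 𝓘(ℂ, Fin m → ℂ) 𝓘(ℂ, Fin (m + 2) → ℂ) ω ι)
    {q : {c ∈ fiberedProduct π π | π c.1 ∈ range ι} → Y} (hq : ∀ c, ι (q c) = π c.1.1) (y : Y) :
    ∃ V : TopologicalSpace.Opens Y, y ∈ V ∧ ConnectedSpace V ∧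
      ∃ Φ : V × (ComplexProjectiveLine × ComplexProjectiveLine) →
        {c ∈ fiberedProduct π π | π c.1 ∈ range ι},
      IsSmoothEmbedding (𝓘(ℂ, Fin m → ℂ).prod (𝓘(ℂ, ℂ).prod 𝓘(ℂ, ℂ)))
        (𝓘(ℂ, Fin (m + 2) → ℂ).prod 𝓘(ℂ, Fin (m + 2) → ℂ)) ω (fun p => (Φ p : W × W)) ∧
      (∀ p, q (Φ p) = p.1) ∧ range Φ = q ⁻¹' V := by
  obtain ⟨φ, g, H, hyφ, h⟩ := hπ.exists_isLocalBlowUpChart (mem_range_self y)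
  have : LocallyConnectedSpace Y := ChartedSpace.locallyConnectedSpace (Fin m → ℂ) Y
  obtain ⟨V, hVs, hV, hyV, hVc⟩ := locallyConnectedSpace_iff_subsets_isOpen_isConnected.1 this y
    (ι ⁻¹' φ.source) ((φ.open_source.preimage hι.isEmbedding.continuous).mem_nhds hyφ)
  have hπH (y : V) (l) : π (H (φ (ι y), l)) = ι y := (h.right_inv_of_center (hVs y.2) l).1
  let Φ : V × (ComplexProjectiveLine × ComplexProjectiveLine) →
      {c ∈ fiberedProduct π π | π c.1 ∈ range ι} := fun p =>
    ⟨(H (φ (ι p.1), p.2.1), H (φ (ι p.1), p.2.2)),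
      (hπH _ _).trans (hπH _ _).symm, p.1, (hπH _ _).symm⟩
  have hqΦ (p) : q (Φ p) = p.1 := hι.isEmbedding.injective ((hq _).trans (hπH _ _))
  refine ⟨⟨V, hV⟩, hyV, isConnected_iff_connectedSpace.1 hVc, Φ,
    h.isSmoothEmbedding_trivialization hι ⟨V, hV⟩ hVs, hqΦ, ?_⟩
  ext c
  constructor
  · rintro ⟨p, rfl⟩
    rw [mem_preimage, hqΦ]
    exact p.1.2
  · intro hc
    refine ⟨(⟨q c, hc⟩, g c.1.1, g c.1.2), Subtype.ext (Prod.ext ?_ ?_)⟩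
    · have hs : π c.1.1 ∈ φ.source := hq c ▸ hVs hc
      change H (φ (ι (q c)), g c.1.1) = c.1.1
      rw [hq, h.left_inv _ hs]
    · have hc2 : π c.1.1 = π c.1.2 := c.2.1
      have hs : π c.1.2 ∈ φ.source := hc2 ▸ hq c ▸ hVs hc
      change H (φ (ι (q c)), g c.1.2) = c.1.2
      rw [hq, hc2, h.left_inv _ hs]

end Bundle

/-! ### The closure of the part off the center, and the two components. -/

theorem closure_fiberedProduct_eq_diagonal {X W : Type*} [TopologicalSpace W] [T2Space W]
    {π : W → X} {Y : Set X} (hinj : InjOn π (π ⁻¹' Yᶜ)) (hd : Dense (π ⁻¹' Yᶜ)) :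
    closure {c ∈ fiberedProduct π π | π c.1 ∉ Y} = diagonal W := by
  have : {c ∈ fiberedProduct π π | π c.1 ∉ Y} = (fun w => (w, w)) '' (π ⁻¹' Yᶜ) := by
    ext ⟨w, w'⟩
    constructor
    · rintro ⟨h : π w = π w', hw : π w ∉ Y⟩
      exact ⟨w, hw, Prod.ext rfl (hinj hw (h ▸ hw : π w' ∉ Y) h)⟩
    · rintro ⟨v, hv, hvw⟩
      obtain ⟨rfl, rfl⟩ := Prod.ext_iff.1 hvw
      exact ⟨rfl, hv⟩
  rw [this]
  refine (closure_minimal ?_ isClosed_diagonal).antisymm ?_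
  · rintro _ ⟨w, -, rfl⟩
    rfl
  · rintro ⟨w, w'⟩ (rfl : w = w')
    exact image_closure_subset_closure_image (f := fun w : W => (w, w)) (by fun_prop)
      ⟨w, hd w, rfl⟩

theorem mainTheorem11 (m : ℕ)
    {X : Type*} [TopologicalSpace X] [T2Space X] [ConnectedSpace X]
    [ChartedSpace (Fin (m + 2) → ℂ) X] [IsManifold 𝓘(ℂ, Fin (m + 2) → ℂ) ω X]
    {Y : Type*} [TopologicalSpace Y] [ConnectedSpace Y]
    [ChartedSpace (Fin m → ℂ) Y] [IsManifold 𝓘(ℂ, Fin m → ℂ) ω Y]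
    (ι : Y → X)
    (hι : IsSmoothEmbedding 𝓘(ℂ, Fin m → ℂ) 𝓘(ℂ, Fin (m + 2) → ℂ) ω ι)
    (hclosed : IsClosed (range ι))
    {W : Type*} [TopologicalSpace W]
    [ChartedSpace (Fin (m + 2) → ℂ) W] [IsManifold 𝓘(ℂ, Fin (m + 2) → ℂ) ω W]
    (π : W → X) (hπ : IsBlowUp m π (range ι)) :
    ∃ C₁ C₂ : Set (W × W),
      -- the irreducible components of the fibered product are `C₁` and `C₂`, exactly two
      analyticComponents (𝓘(ℂ, Fin (m + 2) → ℂ).prod 𝓘(ℂ, Fin (m + 2) → ℂ))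
        (fiberedProduct π π) = {C₁, C₂} ∧
      C₁ ≠ C₂ ∧
      -- `C₁` is the part over `Y`, and it is a `ℂP(1) × ℂP(1)`-bundle over `Y`
      C₁ = {c ∈ fiberedProduct π π | π c.1 ∈ range ι} ∧
      (∃ q : C₁ → Y, (∀ c, ι (q c) = π c.1.1) ∧
        IsHolomorphicFiberBundle 𝓘(ℂ, Fin m → ℂ)
          (𝓘(ℂ, ℂ).prod 𝓘(ℂ, ℂ)) (ComplexProjectiveLine × ComplexProjectiveLine)
          (𝓘(ℂ, Fin (m + 2) → ℂ).prod 𝓘(ℂ, Fin (m + 2) → ℂ)) C₁ q) ∧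
      -- `C₂` is the closure of the part over `X ∖ Y`, and it is a copy of `W` over `X`
      C₂ = closure {c ∈ fiberedProduct π π | π c.1 ∉ range ι} ∧
      (∃ δ : W → W × W,
        IsSmoothEmbedding 𝓘(ℂ, Fin (m + 2) → ℂ)
          (𝓘(ℂ, Fin (m + 2) → ℂ).prod 𝓘(ℂ, Fin (m + 2) → ℂ)) ω δ ∧
        range δ = C₂ ∧ ∀ w, π (δ w).1 = π w) := by
  have : T2Space W := hπ.t2Space
  have : ConnectedSpace W := hπ.connectedSpace hclosed
  have hpp : ContMDiff (𝓘(ℂ, Fin (m + 2) → ℂ).prod 𝓘(ℂ, Fin (m + 2) → ℂ))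
      (𝓘(ℂ, Fin (m + 2) → ℂ).prod 𝓘(ℂ, Fin (m + 2) → ℂ)) ω (Prod.map π π) :=
    hπ.holomorphic.prodMap hπ.holomorphic
  set C₁ : Set (W × W) := {c ∈ fiberedProduct π π | π c.1 ∈ range ι} with hC₁
  -- Injectivity of `ι` makes `q` unique, and `ι ∘ q = π ∘ fst` on `C₁` yields its continuity, `ι`
  -- being an embedding.
  choose q hq using fun c : C₁ => c.2.2
  have htriv := hπ.exists_trivialization hι hq
  have hclosure := closure_fiberedProduct_eq_diagonal hπ.bijOn.injOn
    (hπ.dense_preimage_compl hclosed (range_nonempty ι))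
  have hδ : range (fun w : W => (w, w)) = diagonal W := by
    ext ⟨w, w'⟩
    simp [eq_comm]
  have hunion : fiberedProduct π π = C₁ ∪ diagonal W := by
    ext ⟨w, w'⟩
    constructor
    · intro h
      by_cases hw : π w ∈ range ι
      · exact Or.inl ⟨h, hw⟩
      · exact Or.inr (hπ.bijOn.injOn hw ((show π w = π w' from h) ▸ hw : π w' ∉ range ι) h)
    · rintro (h | (rfl : w = w'))
      · exact h.1
      · rfl
  have h₁₂ : ¬ C₁ ⊆ diagonal W := by
    intro hsub
    obtain ⟨y⟩ : Nonempty Y := inferInstance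
    obtain ⟨φ, g, H, hyφ, h⟩ := hπ.exists_isLocalBlowUpChart (mem_range_self y)
    -- The lines with affine coordinates 0 and 1 give two distinct points of `W` over the same point
    -- of the center.
    let l (t : ℂ) := ComplexProjectiveLine.mk (ComplexProjectiveLine.affineVec 0 t)
    have hl (t : ℂ) := h.right_inv_of_center hyφ (l t)
    have heq : H (φ (ι y), l 0) = H (φ (ι y), l 1) :=
      @hsub (H (φ (ι y), l 0), H (φ (ι y), l 1))
        ⟨(hl 0).1.trans (hl 1).1.symm, y, (hl 0).1.symm⟩
    have h01 : l 0 = l 1 := by rw [← (hl 0).2, heq, (hl 1).2]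
    have := congrArg (ComplexProjectiveLine.ratio 0) h01
    rw [ComplexProjectiveLine.ratio_mk_affineVec,
      ComplexProjectiveLine.ratio_mk_affineVec] at this
    exact zero_ne_one this
  have h₂₁ : ¬ diagonal W ⊆ C₁ := by
    intro hsub
    obtain ⟨x, hx⟩ := hπ.exists_notMem_center (range_nonempty ι)
    obtain ⟨w, rfl⟩ := hπ.surjective x
    exact hx (hsub (mem_diagonal w)).2
  refine ⟨C₁, diagonal W, ?_, ?_, rfl, ⟨q, hq, ?_, ?_⟩, hclosure.symm,
    ⟨fun w => (w, w), isSmoothEmbedding_diagonal, hδ, fun _ => rfl⟩⟩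
  · rw [hunion]
    refine analyticComponents_union ?_ (isClosed_analyticZariskiTopology (.diagonal _ W)) ?_ ?_
      h₁₂ h₂₁
    · have h1 := isClosed_analyticZariskiTopology ((IsAnalyticSubset.diagonal (m + 2) X).preimage hpp)
      have h2 := isClosed_analyticZariskiTopology
        ((hπ.isAnalyticSubset_center hclosed).preimage (hπ.holomorphic.comp contMDiff_fst)
          (I' := 𝓘(ℂ, Fin (m + 2) → ℂ).prod 𝓘(ℂ, Fin (m + 2) → ℂ)) (N := W × W))
      exact @IsClosed.inter _ _ _ (_) h1 h2
    · refine isIrreducible_of_trivializations (q := q) (IB := 𝓘(ℂ, Fin m → ℂ))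
        (IF := 𝓘(ℂ, ℂ).prod 𝓘(ℂ, ℂ)) (F := ComplexProjectiveLine × ComplexProjectiveLine)
        fun y => ?_
      obtain ⟨V, hyV, hV, Φ, hΦ, hqΦ, hr⟩ := htriv y
      exact ⟨V, hyV, hV, Φ, hΦ.contMDiff, hqΦ, hr⟩
    · rw [← hδ]
      exact isIrreducible_range_of_contMDiff isSmoothEmbedding_diagonal.contMDiff
  · exact fun h => h₁₂ h.subset
  · rw [hι.isEmbedding.continuous_iff]
    refine (hπ.holomorphic.continuous.comp (continuous_fst.comp continuous_subtype_val)).congr ?_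
    exact fun c => (hq c).symm
  · intro y
    obtain ⟨V, hyV, -, h⟩ := htriv y
    exact ⟨V, hyV, h⟩
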